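/- Let $\xi(s)=s(s-1)\pi^{-s/2}\Gamma(s/2)\zeta(s)$ (an entire function), let $\ell=\xi'/\xi$, and let $\rho$ run over the nontrivial zeros of $\zeta$ (those with $0<\Re\rho<1$), counted with multiplicity. For $x\in\mathbb{C}$ and $\tau\in\mathbb{R}\setminus\{0\}$ put $$F(x,\tau)=\frac1\tau\sum_{\rho}\Big[1-\Big(\frac{\rho}{\rho-\tau}\Big)^{x}\Big],$$ where powers are principal and the terms of $\rho$ and $1-\rho$ are paired together, and let $F(x,0)=\lim_{\tau\to0}F(x,\tau)$. Put $$\ell_k(\tau)=\frac1{k!}\frac{d^k}{d\tau^k}\big[\ell(\tau)\big],\qquad k=0,1,2,\dots$$ Then for every $x\in\mathbb{C}$ the paired sum converges absolutely for all real $\tau$, and the limit defining $F(x,0)$ exists. Moreover $$F(x,\tau)=\sum_{k=0}^{\infty}\frac{\Gamma(x+1)}{(k+1)!\,\Gamma(x-k)}\,\ell_k(\tau)\,\tau^k ,$$ with absolute convergence of the series, for every $x\in\mathbb{C}$ and every $\tau\in\mathbb{R}$ such that $|\tau|<|\rho-\tau|$ for all nontrivial zeros $\rho$, and, if $x$ is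 a nonnegative integer, for every $\tau\in\mathbb{R}$. Here $\Gamma(x+1)/\Gamma(x-k)$ is understood as an entire function of $x$, i.e. as its limit $x(x-1)\cdots(x-k)$ wherever $\Gamma(x+1)$ or $\Gamma(x-k)$ has a pole. -/

import Mathlib

open Filter Topology

noncomputable section

/-- The entire function `ξ(s) = s (s - 1) π^(-s/2) Γ(s/2) ζ(s)`. It is written through the entire
part `Λ₀(s) = π^(-s/2) Γ(s/2) ζ(s) + 1/s + 1/(1 - s)` of the completed zeta function, so that it has
the right values also at the removable singularities of the product;
see `xi_eq` for the agreement with the product. -/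
def xi (s : ℂ) : ℂ := s * (s - 1) * completedRiemannZeta₀ s + 1

theorem xi_eq {s : ℂ} (h1 : s ≠ 1) (hs : Complex.Gammaℝ s ≠ 0) (h0 : s ≠ 0) :
    xi s = s * (s - 1) * (Real.pi : ℂ) ^ (-s / 2) * Complex.Gamma (s / 2) * riemannZeta s := by
  have h1' : s - 1 ≠ 0 := sub_ne_zero.mpr h1
  have h1'' : 1 - s ≠ 0 := sub_ne_zero.mpr (Ne.symm h1)
  have hG : (Real.pi : ℂ) ^ (-s / 2) * Complex.Gamma (s / 2) = Complex.Gammaℝ s := by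
    rw [Complex.Gammaℝ_def]
  rw [mul_assoc (s * (s - 1)), hG, riemannZeta_def_of_ne_zero h0, mul_assoc (s * (s - 1)),
    mul_div_cancel₀ _ hs, completedRiemannZeta_eq, xi]
  field_simp
  ring

/-- The nontrivial zeros of the Riemann zeta function: those in the open critical strip. -/
def zetaZeros : Set ℂ := {ρ | 0 < ρ.re ∧ ρ.re < 1 ∧ riemannZeta ρ = 0}

/-- The summand `1 - (ρ / (ρ - τ))^x` (principal power; for real `τ` and nonreal `ρ` the base never
lies on the closed negative real axis). -/
def zeroTerm (x : ℂ) (τ : ℝ) (ρ : ℂ) : ℂ := 1 - (ρ / (ρ - τ)) ^ x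

/-- The contribution of the zero `ρ`, taken with its multiplicity, after `ρ` and `1 - ρ` are paired:
each of the two (they have the same multiplicity) carries one half of the sum of the two summands,
so that the sum over all `ρ` is the sum over the pairs `{ρ, 1 - ρ}`. -/
def pairedTerm (x : ℂ) (τ : ℝ) (ρ : zetaZeros) : ℂ :=
  (analyticOrderNatAt riemannZeta (ρ : ℂ) : ℂ) *
    ((zeroTerm x τ (ρ : ℂ) + zeroTerm x τ (1 - (ρ : ℂ))) / 2)

/-- `(1/τ) ∑_ρ [1 - (ρ / (ρ - τ))^x]`, the zeros `ρ` and `1 - ρ` being paired, for `τ ≠ 0`. -/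
def zeroSum (x : ℂ) (τ : ℝ) : ℂ := (1 / (τ : ℂ)) * ∑' ρ : zetaZeros, pairedTerm x τ ρ

/-- The function `F(x, τ)`: the sum over the zeros for `τ ≠ 0`, extended to `τ = 0` by
its limit. -/
def F (x : ℂ) (τ : ℝ) : ℂ :=
  if τ = 0 then limUnder (𝓝[≠] (0 : ℝ)) (zeroSum x) else zeroSum x τ

/-- `ℓ_k(τ) = (1/k!) (d/dτ)^k [ξ'/ξ](τ)`. -/
def ell (k : ℕ) (τ : ℝ) : ℂ :=
  1 / (k.factorial : ℂ) * iteratedDeriv k (fun s : ℂ => deriv xi s / xi s) τ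

open Classical in
/-- The quotient `Γ(x + 1) / Γ(x - k)` as an entire function of `x`. At the negative integers, where
both Gamma functions have poles, the value of the quotient is its limit `x (x - 1) ⋯ (x - k)`. (At
a nonnegative integer `x ≤ k` only the denominator has a pole and the quotient is `0`, in accordance
with `Complex.Gamma` being `0` at its poles.) -/
def gammaQuot (x : ℂ) (k : ℕ) : ℂ :=
  if ∃ m : ℕ, x = -((m : ℂ) + 1) then ∏ j ∈ Finset.range (k + 1), (x - j)
  else Complex.Gamma (x + 1) / Complex.Gamma (x - k)

end

/-! Put v = 1/(ρ - τ). Then ρ/(ρ - τ) = 1 + τv, and the binomial series gives 1 - (ρ/(ρ - τ))^x =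
-∑ₖ C(x, k+1) τ^(k+1) v^(k+1). Summed over the zeros, v^(k+1) becomes a power sum Sₖ(τ). Expanding
ξ'/ξ(s) = ∑ 1/(s - ρ) about τ gives ℓₖ(τ) = -Sₖ(τ) (`ell_eq_neg_zetaZeroPowerSum`), and
Γ(x+1)/((k+1)! Γ(x-k)) = C(x, k+1), so the claim is an interchange of summations
(`hasSum_mul_zetaZeroPowerSum`). This is legitimate because ∑ |ρ - τ|⁻² converges, which controls k
≥ 1, while pairing ρ with 1 - ρ gains the missing power for k = 0. As |ρ - τ| → ∞, the hypothesis
|τ| < |ρ - τ| is automatically uniform in ρ.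

The partial fractions (`hasSum_logDeriv_xi`) come from the growth ξ(1/2 + w) = exp(o(|w|²)) and the
evenness in w, by dividing out the zeros in a large disc and applying Borel–Carathéodory to the
quotient. No zero counting is needed: taking real parts at s = 2 already yields the convergence of ∑
|ρ - 2|⁻². Real τ are admissible since ξ has no real zero. The limit at τ = 0 follows from the
first-order Taylor bound for (1 + u)^x, uniformly in ρ. -/

/-! ### Bounds for the Mellin transform and the absence of real zeros of ξ -/

/-- The kernel of the Mellin transform `completedRiemannZeta₀` is real and nonnegative. -/
theorem hurwitzEvenFEPair_zero_f_modif_nonneg {t : ℝ} (ht : 0 < t) :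
    ∃ r : ℝ, 0 ≤ r ∧ (HurwitzZeta.hurwitzEvenFEPair 0).f_modif t = r := by
  -- The theta series is 1, from n = 0, plus positive terms. The functional equation carries this
  -- bound to t < 1.
  have key : ∀ {u : ℝ}, 0 < u → 1 ≤ HurwitzZeta.evenKernel 0 u := fun {u} hu ↦ by
    have h := (HurwitzZeta.hasSum_int_evenKernel₀ 0 hu).nonneg fun n ↦ by positivity
    simpa using h
  rcases lt_trichotomy t 1 with h | h | h
  · refine ⟨HurwitzZeta.evenKernel 0 t - t ^ (-(1 / 2 : ℝ)), ?_, ?_⟩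
    · rw [HurwitzZeta.evenKernel_functional_equation, ← HurwitzZeta.evenKernel_eq_cosKernel_of_zero,
        Real.rpow_neg ht.le, ← one_div, sub_nonneg]
      have := key (one_div_pos.2 ht)
      exact le_mul_of_one_le_right (by positivity) this
    · have h1 : t ∉ Set.Ioi (1 : ℝ) := by simpa using h.le
      have h2 : t ∈ Set.Ioo (0 : ℝ) 1 := ⟨ht, h⟩
      simp [WeakFEPair.f_modif, h1, h2, HurwitzZeta.hurwitzEvenFEPair]
  · exact ⟨0, le_rfl, by simp [WeakFEPair.f_modif, h]⟩
  · refine ⟨HurwitzZeta.evenKernel 0 t - 1, sub_nonneg.2 (key ht), ?_⟩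
    have h1 : t ∈ Set.Ioi (1 : ℝ) := h
    have h2 : t ∉ Set.Ioo (0 : ℝ) 1 := fun h' ↦ h'.2.not_gt h
    simp [WeakFEPair.f_modif, h1, h2, HurwitzZeta.hurwitzEvenFEPair]

theorem integrableOn_rpow_mul_norm_f_modif (σ : ℝ) :
    MeasureTheory.IntegrableOn (fun t : ℝ ↦ t ^ (σ - 1) *
      ‖(HurwitzZeta.hurwitzEvenFEPair 0).f_modif t‖) (Set.Ioi 0) := by
  have h := ((HurwitzZeta.hurwitzEvenFEPair 0).isStrongFEPair_toStrongFEPair.hasMellin σ).1.norm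
  refine h.congr ?_
  filter_upwards [MeasureTheory.ae_restrict_mem measurableSet_Ioi] with t ht
  rw [norm_smul, Complex.norm_cpow_eq_rpow_re_of_pos ht]
  simp [WeakFEPair.toStrongFEPair]

theorem completedRiemannZeta₀_ofReal (σ : ℝ) :
    completedRiemannZeta₀ σ = ((∫ t in Set.Ioi (0 : ℝ), t ^ (σ / 2 - 1) *
      ‖(HurwitzZeta.hurwitzEvenFEPair 0).f_modif t‖) / 2 : ℝ) := by
  rw [completedRiemannZeta₀, HurwitzZeta.completedHurwitzZetaEven₀, WeakFEPair.Λ₀, mellin]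
  push_cast
  congr 1
  rw [← integral_complex_ofReal]
  refine MeasureTheory.setIntegral_congr_fun measurableSet_Ioi fun t (ht : 0 < t) ↦ ?_
  obtain ⟨r, hr, h⟩ := hurwitzEvenFEPair_zero_f_modif_nonneg ht
  simp only [h, Complex.norm_real, Real.norm_of_nonneg hr, smul_eq_mul]
  push_cast [Complex.ofReal_cpow ht.le]
  rfl

/-- In the Mellin integral, |t^(s/2-1)| is at most t^(b/2-1) for t ≥ 1 and t^(a/2-1) for t ≤ 1. As
the kernel is nonnegative, the resulting integrals are the values at the real points a and b
themselves. -/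
theorem norm_completedRiemannZeta₀_le {s : ℂ} {a b : ℝ} (ha : a ≤ s.re) (hb : s.re ≤ b) :
    ‖completedRiemannZeta₀ s‖ ≤ (completedRiemannZeta₀ a).re + (completedRiemannZeta₀ b).re := by
  rw [completedRiemannZeta₀_ofReal, completedRiemannZeta₀_ofReal, Complex.ofReal_re,
    Complex.ofReal_re, ← add_div, ← MeasureTheory.integral_add
      (integrableOn_rpow_mul_norm_f_modif _) (integrableOn_rpow_mul_norm_f_modif _),
    completedRiemannZeta₀, HurwitzZeta.completedHurwitzZetaEven₀, WeakFEPair.Λ₀, mellin, norm_div,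
    Complex.norm_ofNat]
  gcongr
  refine MeasureTheory.norm_integral_le_of_norm_le ((integrableOn_rpow_mul_norm_f_modif _).add
    (integrableOn_rpow_mul_norm_f_modif _)) ?_
  filter_upwards [MeasureTheory.ae_restrict_mem measurableSet_Ioi] with t (ht : 0 < t)
  rw [norm_smul, Complex.norm_cpow_eq_rpow_re_of_pos ht, ← add_mul]
  gcongr
  have hre : (s / 2 - 1).re = s.re / 2 - 1 := by simp
  rw [hre]
  rcases le_total 1 t with h | h
  · exact (Real.rpow_le_rpow_of_exponent_le h (by linarith)).trans
      (le_add_of_nonneg_left (by positivity))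
  · exact (Real.rpow_le_rpow_of_exponent_ge ht h (by linarith)).trans
      (le_add_of_nonneg_right (by positivity))

theorem differentiable_xi : Differentiable ℂ xi := by
  have := differentiable_completedZeta₀
  unfold xi
  fun_prop

theorem xi_one_sub (s : ℂ) : xi (1 - s) = xi s := by
  rw [xi, xi, completedRiemannZeta₀_one_sub]
  ring

theorem xi_zero : xi 0 = 1 := by simp [xi]

/-- A zero σ would give σ(1 - σ)Λ₀(σ) = 1, hence |Λ₀(σ)| ≥ 4. But |Λ₀(σ)| ≤ Λ₀(0) + Λ₀(1) = 2Λ₀(1) =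
γ - log 4π + 2 < 4. -/
theorem xi_ofReal_ne_zero_of_mem_Ioo {σ : ℝ} (h0 : 0 < σ) (h1 : σ < 1) : xi σ ≠ 0 := by
  intro h
  have hb : ‖completedRiemannZeta₀ σ‖ ≤ _ :=
    norm_completedRiemannZeta₀_le (s := σ) (a := 0) (b := 1) (by simpa using h0.le)
      (by simpa using h1.le)
  have h01 : completedRiemannZeta₀ ((0 : ℝ) : ℂ) = completedRiemannZeta₀ ((1 : ℝ) : ℂ) := by
    rw [← completedRiemannZeta₀_one_sub]; simp
  rw [h01, Complex.ofReal_one, completedRiemannZeta₀_one] at hb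
  have hre : ((((Real.eulerMascheroniConstant : ℂ) - Complex.log (4 * Real.pi)) / 2 + 1)).re =
      (Real.eulerMascheroniConstant - Real.log (4 * Real.pi)) / 2 + 1 := by
    rw [show (4 * Real.pi : ℂ) = ((4 * Real.pi : ℝ) : ℂ) by push_cast; rfl,
      ← Complex.ofReal_log (by positivity)]
    norm_cast
  rw [hre] at hb
  have hlog : 0 ≤ Real.log (4 * Real.pi) := Real.log_nonneg (by linarith [Real.pi_gt_three])
  have hγ := Real.eulerMascheroniConstant_lt_two_thirds
  have hb4 : ‖completedRiemannZeta₀ σ‖ < 4 := by linarith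
  have heq : (σ : ℂ) * (1 - σ) * completedRiemannZeta₀ σ = 1 := by
    rw [xi] at h
    linear_combination -h
  have hn : σ * (1 - σ) * ‖completedRiemannZeta₀ σ‖ = 1 := by
    have := congrArg norm heq
    rw [norm_mul, show (σ : ℂ) * (1 - σ) = ((σ * (1 - σ) : ℝ) : ℂ) by push_cast; rfl,
      Complex.norm_real, Real.norm_of_nonneg (by nlinarith), norm_one] at this
    exact this
  nlinarith [sq_nonneg (σ - 1 / 2), norm_nonneg (completedRiemannZeta₀ σ),
    mul_pos h0 (sub_pos.2 h1)]

theorem xi_eq_mul_riemannZeta {s : ℂ} (h : 0 < s.re) (h1 : s ≠ 1) :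
    xi s = s * (s - 1) * Complex.Gammaℝ s * riemannZeta s := by
  rw [xi_eq h1 (Complex.Gammaℝ_ne_zero_of_re_pos h) (by rintro rfl; simp at h), Complex.Gammaℝ_def]
  ring

theorem xi_one : xi 1 = 1 := by simp [xi]

theorem xi_ne_zero_of_one_le_re {s : ℂ} (h : 1 ≤ s.re) : xi s ≠ 0 := by
  by_cases h1 : s = 1
  · simp [h1, xi_one]
  · have h0 : 0 < s.re := by linarith
    rw [xi_eq_mul_riemannZeta h0 h1]
    have hs0 : s ≠ 0 := by rintro rfl; simp at h0
    exact mul_ne_zero (mul_ne_zero (mul_ne_zero hs0 (sub_ne_zero.2 h1))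
      (Complex.Gammaℝ_ne_zero_of_re_pos h0)) (riemannZeta_ne_zero_of_one_le_re h)

theorem xi_eq_zero_iff {s : ℂ} : xi s = 0 ↔ s ∈ zetaZeros := by
  constructor
  · intro h
    have h1 : s.re < 1 := not_le.1 fun h' ↦ xi_ne_zero_of_one_le_re h' h
    have h0 : 0 < s.re := not_le.1 fun h' ↦
      xi_ne_zero_of_one_le_re (s := 1 - s) (by simpa using h') (by rwa [xi_one_sub])
    refine ⟨h0, h1, ?_⟩
    have hs1 : s ≠ 1 := by rintro rfl; simp at h1
    have hs0 : s ≠ 0 := by rintro rfl; simp at h0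
    rw [xi_eq_mul_riemannZeta h0 hs1] at h
    simpa [hs0, sub_ne_zero.2 hs1, Complex.Gammaℝ_ne_zero_of_re_pos h0] using h
  · rintro ⟨h0, h1, h⟩
    rw [xi_eq_mul_riemannZeta h0 (by rintro rfl; simp at h1), h, mul_zero]

theorem xi_ofReal_ne_zero (σ : ℝ) : xi σ ≠ 0 := fun h ↦ by
  obtain ⟨h0, h1, -⟩ := xi_eq_zero_iff.1 h
  exact xi_ofReal_ne_zero_of_mem_Ioo (by simpa using h0) (by simpa using h1) h

/-! ### Growth of ξ -/

/-- At even integers the Gamma factor is π^(-m) (m-1)! and |ζ(2m)| ≤ ζ(2), so Stirling's formula is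
not needed. -/
theorem exists_norm_completedRiemannZeta₀_two_mul_le :
    ∃ C : ℝ, 0 ≤ C ∧ ∀ m : ℕ, 1 ≤ m →
      ‖completedRiemannZeta₀ ((2 * m : ℕ) : ℂ)‖ ≤ C * (m : ℝ) ^ m := by
  have hs : Summable fun n : ℕ ↦ 1 / (n : ℝ) ^ 2 := by simp
  refine ⟨(∑' n : ℕ, 1 / (n : ℝ) ^ 2) + 2, by positivity, fun m hm ↦ ?_⟩
  have hζ : ‖riemannZeta ((2 * m : ℕ) : ℂ)‖ ≤ ∑' n : ℕ, 1 / (n : ℝ) ^ 2 := by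
    rw [zeta_nat_eq_tsum_of_gt_one (by omega)]
    refine tsum_of_norm_bounded hs.hasSum fun n ↦ ?_
    rcases Nat.eq_zero_or_pos n with rfl | hn
    · simp [show m ≠ 0 by omega]
    · rw [norm_div, norm_one, norm_pow, Complex.norm_natCast]
      gcongr
      · exact_mod_cast hn
      · omega
  have hG : ‖Complex.Gammaℝ ((2 * m : ℕ) : ℂ)‖ ≤ (m : ℝ) ^ m := by
    obtain ⟨k, rfl⟩ : ∃ k, m = k + 1 := ⟨m - 1, by omega⟩
    have h2 : (((2 * (k + 1) : ℕ) : ℂ)) / 2 = (k : ℂ) + 1 := by push_cast; ring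
    rw [Complex.Gammaℝ_def, neg_div, h2, Complex.Gamma_nat_eq_factorial, norm_mul,
      Complex.norm_cpow_eq_rpow_re_of_pos Real.pi_pos, Complex.norm_natCast]
    have h3 : Real.pi ^ (-((k : ℂ) + 1)).re ≤ 1 :=
      Real.rpow_le_one_of_one_le_of_nonpos (by linarith [Real.pi_gt_three]) (by simp; linarith)
    have h4 : ((k.factorial : ℕ) : ℝ) ≤ ((k + 1 : ℕ) : ℝ) ^ (k + 1) := by
      have h5 := (Nat.factorial_le (Nat.le_succ k)).trans (Nat.factorial_le_pow (k + 1))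
      exact_mod_cast h5
    calc _ ≤ 1 * ((k.factorial : ℕ) : ℝ) := by gcongr
      _ ≤ _ := by rw [one_mul]; exact h4
  have hm0 : ((2 * m : ℕ) : ℂ) ≠ 0 := by exact_mod_cast (by omega : 2 * m ≠ 0)
  have hre : 0 < (((2 * m : ℕ) : ℂ)).re := by
    rw [Complex.natCast_re]; exact_mod_cast (by omega : 0 < 2 * m)
  have hΛ := completedRiemannZeta_eq ((2 * m : ℕ) : ℂ)
  rw [← div_mul_cancel₀ (completedRiemannZeta ((2 * m : ℕ) : ℂ))
    (Complex.Gammaℝ_ne_zero_of_re_pos hre), ← riemannZeta_def_of_ne_zero hm0] at hΛ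
  have h1 : ‖1 / ((2 * m : ℕ) : ℂ)‖ ≤ 1 := by
    rw [norm_div, norm_one, Complex.norm_natCast]
    exact div_le_one_of_le₀ (by exact_mod_cast (by omega : 1 ≤ 2 * m)) (by positivity)
  have h2 : ‖1 / (1 - ((2 * m : ℕ) : ℂ))‖ ≤ 1 := by
    rw [show (1 : ℂ) - ((2 * m : ℕ) : ℂ) = -((2 * m - 1 : ℕ) : ℂ) by
      rw [Nat.cast_sub (by omega)]; push_cast; ring, norm_div, norm_one, norm_neg,
      Complex.norm_natCast]
    exact div_le_one_of_le₀ (by exact_mod_cast (by omega : 1 ≤ 2 * m - 1)) (by positivity)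
  have hmm : (1 : ℝ) ≤ (m : ℝ) ^ m := one_le_pow₀ (by exact_mod_cast hm)
  calc ‖completedRiemannZeta₀ ((2 * m : ℕ) : ℂ)‖
      = ‖riemannZeta ((2 * m : ℕ) : ℂ) * Complex.Gammaℝ ((2 * m : ℕ) : ℂ)
        + 1 / ((2 * m : ℕ) : ℂ) + 1 / (1 - ((2 * m : ℕ) : ℂ))‖ := by
        rw [hΛ]; congr 1; ring
    _ ≤ (∑' n : ℕ, 1 / (n : ℝ) ^ 2) * (m : ℝ) ^ m + 1 + 1 := by
        refine (norm_add₃_le).trans ?_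
        rw [norm_mul]
        gcongr
    _ ≤ _ := by linarith

/-- With m = n + 1, the real part of 1/2 + w lies between 1 - 2m and 2m, two points where Λ₀ agrees
by the functional equation. -/
theorem exists_norm_xi_le : ∃ C : ℝ, 1 ≤ C ∧ ∀ (n : ℕ) (w : ℂ), ‖w‖ ≤ 2 * n →
    ‖xi (1 / 2 + w)‖ ≤ C * (2 * n + 2 : ℝ) ^ (2 * n + 4) := by
  obtain ⟨C, hC, h⟩ := exists_norm_completedRiemannZeta₀_two_mul_le
  refine ⟨2 * C + 1, by linarith, fun n w hw ↦ ?_⟩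
  have hre := abs_le.1 ((Complex.abs_re_le_norm w).trans hw)
  set m := n + 1 with hm
  have hmn : (m : ℝ) = n + 1 := by simp [hm]
  have hm2 : (((2 * m : ℕ) : ℝ) : ℂ) = ((2 * m : ℕ) : ℂ) := by norm_cast
  have hΛ : ‖completedRiemannZeta₀ (1 / 2 + w)‖ ≤ 2 * (C * (m : ℝ) ^ m) := by
    have h1 := norm_completedRiemannZeta₀_le (s := 1 / 2 + w) (a := 1 - (2 * m : ℕ))
      (b := (2 * m : ℕ)) (by simp [hmn]; linarith) (by simp [hmn]; linarith)
    have h2 : completedRiemannZeta₀ ((1 - (2 * m : ℕ) : ℝ) : ℂ) =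
        completedRiemannZeta₀ ((2 * m : ℕ) : ℂ) := by
      rw [← completedRiemannZeta₀_one_sub ((2 * m : ℕ) : ℂ)]; push_cast; rfl
    rw [h2, hm2] at h1
    have h3 := (Complex.re_le_norm _).trans (h m (by omega))
    linarith
  have hA : ‖(1 / 2 + w) * (1 / 2 + w - 1)‖ ≤ (2 * n + 2 : ℝ) ^ 2 := by
    rw [norm_mul, sq]
    gcongr
    · calc ‖1 / 2 + w‖ ≤ ‖(1 / 2 : ℂ)‖ + ‖w‖ := norm_add_le _ _
        _ ≤ 2 * n + 2 := by norm_num; linarith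
    · calc ‖1 / 2 + w - 1‖ = ‖w - 1 / 2‖ := by congr 1; ring
        _ ≤ ‖w‖ + ‖(1 / 2 : ℂ)‖ := norm_sub_le _ _
        _ ≤ 2 * n + 2 := by norm_num; linarith
  have hB : (m : ℝ) ^ m ≤ (2 * n + 2 : ℝ) ^ (2 * n + 2) := by
    have h1 : (1 : ℝ) ≤ 2 * n + 2 := by linarith [(n.cast_nonneg : (0 : ℝ) ≤ n)]
    calc (m : ℝ) ^ m ≤ (2 * n + 2 : ℝ) ^ m := by
          gcongr; rw [hmn]; linarith [(n.cast_nonneg : (0 : ℝ) ≤ n)]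
      _ ≤ _ := pow_le_pow_right₀ h1 (by omega)
  have hone : (1 : ℝ) ≤ (2 * n + 2 : ℝ) ^ (2 * n + 4) :=
    one_le_pow₀ (by linarith [(n.cast_nonneg : (0 : ℝ) ≤ n)])
  calc ‖xi (1 / 2 + w)‖ ≤ ‖(1 / 2 + w) * (1 / 2 + w - 1)‖ * ‖completedRiemannZeta₀ (1 / 2 + w)‖
        + 1 := by
        rw [xi]; refine (norm_add_le _ _).trans ?_; rw [norm_mul, norm_one]
    _ ≤ (2 * n + 2 : ℝ) ^ 2 * (2 * (C * (2 * n + 2 : ℝ) ^ (2 * n + 2))) + 1 := by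
        gcongr; exact hΛ.trans (by gcongr)
    _ = 2 * C * (2 * n + 2 : ℝ) ^ (2 * n + 4) + 1 := by ring
    _ ≤ _ := by linarith

/-- The function `w ↦ ξ(1/2 + w)` is `exp(o(|w|²))`. -/
theorem exists_growth_xi : ∃ M : ℕ → ℝ, (∀ n, 0 < M n) ∧
    (∀ (n : ℕ) (w : ℂ), ‖w‖ ≤ 2 * n → ‖xi (1 / 2 + w)‖ ≤ Real.exp (M n)) ∧
    Tendsto (fun n ↦ M n / (n : ℝ) ^ 2) atTop (𝓝 0) := by
  obtain ⟨C, hC, h⟩ := exists_norm_xi_le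
  have hn0 : ∀ n : ℕ, (0 : ℝ) ≤ n := fun n ↦ n.cast_nonneg
  refine ⟨fun n ↦ Real.log C + (2 * n + 4 : ℕ) * Real.log (2 * n + 2), fun n ↦ ?_,
    fun n w hw ↦ ?_, ?_⟩
  · have := Real.log_nonneg hC
    have : 0 < Real.log (2 * n + 2) := Real.log_pos (by linarith [hn0 n])
    positivity
  · rw [Real.exp_add, Real.exp_log (by linarith), ← Real.log_pow,
      Real.exp_log (pow_pos (by linarith [hn0 n]) _)]
    exact h n w hw
  · have hlog : Tendsto (fun n : ℕ ↦ Real.log (2 * n + 2) / (2 * n + 2)) atTop (𝓝 0) := by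
      have h1 : Tendsto (fun n : ℕ ↦ (2 * n + 2 : ℝ)) atTop atTop :=
        tendsto_atTop_add_const_right _ _
          (tendsto_natCast_atTop_atTop.const_mul_atTop (by norm_num : (0 : ℝ) < 2))
      exact (Real.isLittleO_log_id_atTop.tendsto_div_nhds_zero).comp h1
    have hinv : Tendsto (fun n : ℕ ↦ (1 / n : ℝ)) atTop (𝓝 0) := tendsto_one_div_atTop_nhds_zero_nat
    have := ((hinv.mul hinv).const_mul (Real.log C)).add
      ((((hinv.const_mul 4).const_add 2).mul ((hinv.const_mul 2).const_add 2)).mul hlog)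
    simp only [mul_zero, add_zero] at this
    refine this.congr' ?_
    filter_upwards [eventually_gt_atTop 0] with n hn
    have h1 : (n : ℝ) ≠ 0 := by exact_mod_cast hn.ne'
    have h2 : (2 * n + 2 : ℝ) ≠ 0 := by positivity
    push_cast
    field_simp

/-! ### Partial fractions for even entire functions -/

theorem analyticOrderAt_ne_top_of_differentiable {f : ℂ → ℂ} (hf : Differentiable ℂ f) {a : ℂ}
    (ha : f a ≠ 0) (z : ℂ) : analyticOrderAt f z ≠ ⊤ := by
  intro h
  have h1 : Set.EqOn f 0 Set.univ :=
    (hf.differentiableOn.analyticOnNhd isOpen_univ).eqOn_zero_of_preconnected_of_eventuallyEq_zero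
      isPreconnected_univ (Set.mem_univ z) (analyticOrderAt_eq_top.1 h)
  exact ha (h1 (Set.mem_univ a))

theorem Differentiable.exists_eq_pow_analyticOrderNatAt_mul {f : ℂ → ℂ} (hf : Differentiable ℂ f)
    {a : ℂ} (ha : analyticOrderAt f a ≠ ⊤) :
    ∃ g : ℂ → ℂ, Differentiable ℂ g ∧ g a ≠ 0 ∧
      ∀ z, f z = (z - a) ^ analyticOrderNatAt f a * g z := by
  obtain ⟨g, hg, hga, hfg⟩ := (hf.analyticAt a).analyticOrderAt_ne_top.1 ha
  refine ⟨Function.update (fun z ↦ f z / (z - a) ^ analyticOrderNatAt f a) a (g a), fun z ↦ ?_,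
    by simpa using hga, fun z ↦ ?_⟩
  · rcases eq_or_ne z a with rfl | hz
    · refine hg.differentiableAt.congr_of_eventuallyEq ?_
      filter_upwards [hfg] with w hw
      rcases eq_or_ne w z with rfl | hwz
      · simp
      · rw [Function.update_of_ne hwz, hw, smul_eq_mul,
          mul_div_cancel_left₀ _ (pow_ne_zero _ (sub_ne_zero.2 hwz))]
    · have h1 : DifferentiableAt ℂ (fun z ↦ f z / (z - a) ^ analyticOrderNatAt f a) z :=
        hf.differentiableAt.div (by fun_prop) (pow_ne_zero _ (sub_ne_zero.2 hz))
      refine h1.congr_of_eventuallyEq ?_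
      filter_upwards [isOpen_ne.mem_nhds hz] with w hw
      rw [Function.update_of_ne hw]
  · rcases eq_or_ne z a with rfl | hz
    · simpa using hfg.self_of_nhds
    · rw [Function.update_of_ne hz, mul_div_cancel₀ _ (pow_ne_zero _ (sub_ne_zero.2 hz))]

/-- Dividing an entire function by the polynomial formed from finitely many of its zeros. -/
theorem Differentiable.exists_eq_prod_pow_mul {f : ℂ → ℂ} (hf : Differentiable ℂ f) {b : ℂ}
    (hb : f b ≠ 0) (Z : Finset ℂ) :
    ∃ g : ℂ → ℂ, Differentiable ℂ g ∧ (∀ a ∈ Z, g a ≠ 0) ∧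
      ∀ z, f z = (∏ a ∈ Z, (z - a) ^ analyticOrderNatAt f a) * g z := by
  induction Z using Finset.induction_on with
  | empty => exact ⟨f, hf, by simp, by simp⟩
  | insert a Z haZ ih =>
    obtain ⟨g, hg, hgZ, hfg⟩ := ih
    have hgb : g b ≠ 0 := fun h ↦ hb (by rw [hfg, h, mul_zero])
    have hP : Differentiable ℂ fun z ↦ ∏ a ∈ Z, (z - a) ^ analyticOrderNatAt f a := by fun_prop
    have hPa : ∏ c ∈ Z, (a - c) ^ analyticOrderNatAt f c ≠ 0 :=
      Finset.prod_ne_zero_iff.2 fun c hc ↦ pow_ne_zero _ <| sub_ne_zero.2 <| by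
        rintro rfl; exact haZ hc
    -- The factors already removed do not vanish at the new point a, so f and g have the same order
    -- there.
    have hord : analyticOrderNatAt f a = analyticOrderNatAt g a := by
      have h1 : f = (fun z ↦ ∏ a ∈ Z, (z - a) ^ analyticOrderNatAt f a) * g := funext hfg
      rw [h1, analyticOrderNatAt, analyticOrderAt_mul (hP.analyticAt a) (hg.analyticAt a),
        (hP.analyticAt a).analyticOrderAt_eq_zero.2 hPa, zero_add, analyticOrderNatAt]
    obtain ⟨h, hh, hha, hgh⟩ := hg.exists_eq_pow_analyticOrderNatAt_mul
      (analyticOrderAt_ne_top_of_differentiable hg hgb a)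
    refine ⟨h, hh, fun c hc ↦ ?_, fun z ↦ ?_⟩
    · rcases Finset.mem_insert.1 hc with rfl | hc
      · exact hha
      · intro h0
        exact hgZ c hc (by rw [hgh, h0, mul_zero])
    · rw [Finset.prod_insert haZ, hfg, hgh, hord]
      ring

/-- A function without zeros on a disc, bounded there by `exp M` times its value at the centre, has
logarithmic derivative `O(M ‖w‖ / R ^ 2)`, if this derivative vanishes at the centre. -/
theorem norm_logDeriv_le_of_norm_le {g : ℂ → ℂ} {R M : ℝ} (hR : 0 < R) (hM : 0 < M)
    (hg : Differentiable ℂ g) (h0 : ∀ z ∈ Metric.ball (0 : ℂ) R, g z ≠ 0)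
    (hb : ∀ z ∈ Metric.ball (0 : ℂ) R, ‖g z‖ ≤ Real.exp M * ‖g 0‖) (hd : logDeriv g 0 = 0)
    {w : ℂ} (hw : ‖w‖ < R / 4) : ‖logDeriv g w‖ ≤ 32 * M / R ^ 2 * ‖w‖ := by
  have hmem0 : (0 : ℂ) ∈ Metric.ball (0 : ℂ) R := Metric.mem_ball_self hR
  have hld : DifferentiableOn ℂ (logDeriv g) (Metric.ball 0 R) := fun z hz ↦
    ((hg.deriv z).div (hg z) (h0 z hz)).differentiableWithinAt
  -- The primitive l is a holomorphic logarithm of g / g(0), and the bound on g says Re l ≤ M.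
  obtain ⟨l, hl0, hl⟩ := hld.isExactOn_ball.with_val_at 0 0
  have hexp : ∀ z ∈ Metric.ball (0 : ℂ) R, g z * Complex.exp (-l z) = g 0 := by
    intro z hz
    have hd' : ∀ z ∈ Metric.ball (0 : ℂ) R,
        HasDerivAt (fun z ↦ g z * Complex.exp (-l z)) 0 z := fun z hz ↦ by
      have h1 := (hg z).hasDerivAt.mul ((hl z hz).neg.cexp)
      refine h1.congr_deriv ?_
      rw [logDeriv_apply]
      have := h0 z hz
      simp only [Pi.neg_apply]
      field_simp
      ring
    have h2 := (convex_ball (0 : ℂ) R).is_const_of_fderivWithin_eq_zero (𝕜 := ℂ)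
      (f := fun z ↦ g z * Complex.exp (-l z))
      (fun z hz ↦ (hd' z hz).differentiableAt.differentiableWithinAt) (fun z hz ↦ by
        rw [fderivWithin_of_isOpen Metric.isOpen_ball hz]
        ext; simp [(hd' z hz).deriv]) hz hmem0
    simpa [hl0] using h2
  have hre : Set.MapsTo l (Metric.ball 0 R) {z | z.re ≤ M} := by
    intro z hz
    have h1 : g z = g 0 * Complex.exp (l z) := by
      rw [← hexp z hz, mul_assoc, ← Complex.exp_add]; simp
    have h2 := hb z hz
    rw [h1, norm_mul, Complex.norm_exp, mul_comm] at h2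
    have h3 := le_of_mul_le_mul_right h2 (norm_pos_iff.2 (h0 0 hmem0))
    exact Real.exp_le_exp.1 h3
  have hldiff : DifferentiableOn ℂ l (Metric.ball 0 R) := fun z hz ↦
    (hl z hz).differentiableAt.differentiableWithinAt
  -- Borel–Carathéodory gives 2M|z|/(R - |z|), which is at most 2M for |z| ≤ R/2.
  have hlb : ∀ z : ℂ, ‖z‖ ≤ R / 2 → ‖l z‖ ≤ 2 * M := by
    intro z hz
    have hzR : z ∈ Metric.ball (0 : ℂ) R := by simp; linarith
    refine (Complex.borelCaratheodory_zero hM hldiff hre hR hzR hl0).trans ?_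
    rw [div_le_iff₀ (by linarith)]
    nlinarith
  -- Cauchy's estimate on circles of radius R/4, which stay inside |u| ≤ R/2.
  have hderiv : ∀ z ∈ Metric.ball (0 : ℂ) (R / 4), ‖logDeriv g z‖ ≤ 2 * M / (R / 4) := by
    intro z hz
    have hz' : ‖z‖ < R / 4 := by simpa using hz
    have hsub : ∀ u ∈ Metric.closedBall z (R / 4), ‖u‖ ≤ R / 2 := fun u hu ↦ by
      have h1 : ‖u - z‖ ≤ R / 4 := by simpa [dist_eq_norm] using hu
      calc ‖u‖ = ‖u - z + z‖ := by simp
        _ ≤ ‖u - z‖ + ‖z‖ := norm_add_le _ _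
        _ ≤ R / 2 := by linarith
    rw [← (hl z (by simp; linarith)).deriv]
    refine Complex.norm_deriv_le_of_forall_mem_sphere_norm_le (by positivity) ?_
      fun u hu ↦ hlb u (hsub u (Metric.sphere_subset_closedBall hu))
    refine DifferentiableOn.diffContOnCl_ball (U := Metric.ball 0 R) hldiff fun u hu ↦ ?_
    have := hsub u hu
    simp
    linarith
  -- Since l'(0) = 0, the Schwarz lemma on the disc of radius R/4 gains the factor |w|/(R/4). This
  -- second factor 1/R is what makes growth exp(o(R²)) sufficient.
  have hschwarz := Complex.dist_le_div_mul_dist_of_mapsTo_ball (f := logDeriv g) (c := 0) (z := w)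
    (R₁ := R / 4) (R₂ := 2 * M / (R / 4)) (hld.mono (Metric.ball_subset_ball (by linarith)))
    (fun z hz ↦ by rw [hd]; simpa using hderiv z hz) (by simpa using hw)
  rw [hd, dist_zero_right, dist_zero_right] at hschwarz
  refine hschwarz.trans_eq ?_
  field_simp
  ring

theorem logDeriv_prod_sub_pow {Z : Finset ℂ} {m : ℂ → ℕ} {w : ℂ} (hw : w ∉ Z) :
    logDeriv (fun z ↦ ∏ a ∈ Z, (z - a) ^ m a) w = ∑ a ∈ Z, (m a : ℂ) / (w - a) := by
  have hne : ∀ a ∈ Z, w - a ≠ 0 := fun a ha ↦ sub_ne_zero.2 (by rintro rfl; exact hw ha)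
  rw [logDeriv_prod (f := fun a z ↦ (z - a) ^ m a) (fun a ha ↦ pow_ne_zero _ (hne a ha))
    (by fun_prop)]
  refine Finset.sum_congr rfl fun a ha ↦ ?_
  rw [logDeriv_fun_pow (by fun_prop)]
  simp [logDeriv_apply, div_eq_mul_inv]

theorem analyticOrderNatAt_neg_of_even {f : ℂ → ℂ} (he : ∀ z, f (-z) = f z) (z : ℂ) :
    analyticOrderNatAt f (-z) = analyticOrderNatAt f z := by
  have h1 : f ∘ (fun z ↦ -z) = f := funext he
  have h2 := analyticOrderAt_comp_of_deriv_ne_zero (f := f) (g := fun z : ℂ ↦ -z) (z₀ := z)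
    (by fun_prop) (by simp)
  rw [h1] at h2
  rw [analyticOrderNatAt, analyticOrderNatAt, h2]

theorem deriv_zero_of_even {f : ℂ → ℂ} (he : ∀ z, f (-z) = f z) : deriv f 0 = 0 := by
  have h1 := deriv_comp_neg f 0
  rw [show (fun x ↦ f (-x)) = f from funext he, neg_zero] at h1
  exact self_eq_neg.1 h1

/-- The logarithmic derivative of an even entire function is approximated by the sum over the
zeros in a large disc. -/
theorem norm_logDeriv_sub_sum_le {f : ℂ → ℂ} {R M : ℝ} (hR : 0 < R) (hM : 0 < M)
    (hf : Differentiable ℂ f) (he : ∀ z, f (-z) = f z) (h0 : f 0 ≠ 0)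
    (hb : ∀ z, ‖z‖ ≤ 2 * R → ‖f z‖ ≤ Real.exp M) {Z : Finset ℂ}
    (hZ : ∀ z, z ∈ Z ↔ f z = 0 ∧ ‖z‖ ≤ R) {w : ℂ} (hw : ‖w‖ < R / 4) (hfw : f w ≠ 0) :
    ‖logDeriv f w - ∑ a ∈ Z, (analyticOrderNatAt f a : ℂ) / (w - a)‖ ≤
      32 * (M + |Real.log ‖f 0‖|) / R ^ 2 * ‖w‖ := by
  obtain ⟨g, hg, hgZ, hfg⟩ := hf.exists_eq_prod_pow_mul h0 Z
  set Q : ℂ → ℂ := fun z ↦ ∏ a ∈ Z, (z - a) ^ analyticOrderNatAt f a with hQ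
  have hQd : Differentiable ℂ Q := by fun_prop
  have hfQ : f = fun z ↦ Q z * g z := funext hfg
  have hld : ∀ z, f z ≠ 0 →
      logDeriv g z = logDeriv f z - ∑ a ∈ Z, (analyticOrderNatAt f a : ℂ) / (z - a) := by
    intro z hz
    have hz' : Q z * g z ≠ 0 := by rw [← hfg z]; exact hz
    have hzZ : z ∉ Z := fun h ↦ hz ((hZ z).1 h).1
    have h1 : logDeriv (fun z ↦ Q z * g z) z = logDeriv Q z + logDeriv g z :=
      logDeriv_mul (f := Q) z (left_ne_zero_of_mul hz') (right_ne_zero_of_mul hz')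
      (hQd z) (hg z)
    rw [← logDeriv_prod_sub_pow hzZ, eq_sub_iff_add_eq', ← h1, ← hfQ]
  have hZne : ∀ z ∈ Metric.ball (0 : ℂ) R, g z ≠ 0 := by
    intro z hz hgz
    exact hgZ z ((hZ z).2 ⟨by rw [hfg, hgz, mul_zero], by simpa using (Metric.mem_ball.1 hz).le⟩)
      hgz
  have hQ0 : Q 0 ≠ 0 := fun h ↦ h0 (by rw [congrFun hfQ 0, h, zero_mul])
  have hsphere : ∀ z : ℂ, ‖z‖ = 2 * R → ‖g z‖ ≤ Real.exp M / ‖Q 0‖ := by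
    intro z hz
    -- For |a| ≤ R and |z| = 2R one has |z - a| ≥ R ≥ |a|, factor by factor.
    have h1 : ‖Q 0‖ ≤ ‖Q z‖ := by
      simp only [hQ, norm_prod, norm_pow]
      gcongr with a ha
      have h2 := ((hZ a).1 ha).2
      rw [zero_sub, norm_neg]
      have := norm_sub_norm_le z a
      linarith
    rw [le_div_iff₀ (norm_pos_iff.2 hQ0)]
    calc ‖g z‖ * ‖Q 0‖ ≤ ‖g z‖ * ‖Q z‖ := by gcongr
      _ = ‖f z‖ := by rw [hfg z, norm_mul, mul_comm]
      _ ≤ _ := hb z hz.le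
  have hgb : ∀ z ∈ Metric.ball (0 : ℂ) R,
      ‖g z‖ ≤ Real.exp (M + |Real.log ‖f 0‖|) * ‖g 0‖ := by
    intro z hz
    have h1 : ‖g z‖ ≤ Real.exp M / ‖Q 0‖ := by
      refine Complex.norm_le_of_forall_mem_frontier_norm_le (U := Metric.ball (0 : ℂ) (2 * R))
        Metric.isBounded_ball hg.diffContOnCl (fun u hu ↦ hsphere u ?_) (subset_closure ?_)
      · rw [frontier_ball _ (by positivity)] at hu
        simpa using hu
      · exact Metric.ball_subset_ball (by linarith) hz
    have h2 : ‖f 0‖ = ‖Q 0‖ * ‖g 0‖ := by rw [hfg 0, norm_mul]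
    have h3 : 1 ≤ Real.exp |Real.log ‖f 0‖| * ‖f 0‖ := by
      rw [← Real.exp_log (norm_pos_iff.2 h0), ← Real.exp_add, Real.log_exp]
      exact Real.one_le_exp (by linarith [neg_abs_le (Real.log ‖f 0‖)])
    refine h1.trans ?_
    rw [div_le_iff₀ (norm_pos_iff.2 hQ0), Real.exp_add]
    calc Real.exp M = Real.exp M * 1 := (mul_one _).symm
      _ ≤ Real.exp M * (Real.exp |Real.log ‖f 0‖| * ‖f 0‖) := by gcongr
      _ = _ := by rw [h2]; ring
  -- By evenness a ↦ -a permutes the zeros with their multiplicities, so the sum at the centre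
  -- equals its own negative.
  have hsum0 : ∑ a ∈ Z, (analyticOrderNatAt f a : ℂ) / (0 - a) = 0 := by
    have h1 : ∑ a ∈ Z, (analyticOrderNatAt f a : ℂ) / (0 - a) =
        ∑ a ∈ Z, -((analyticOrderNatAt f a : ℂ) / (0 - a)) := by
      refine Finset.sum_equiv (Equiv.neg ℂ) (fun a ↦ by simp [hZ, he]) fun a _ ↦ ?_
      simp [analyticOrderNatAt_neg_of_even he, div_neg]
    rw [Finset.sum_neg_distrib] at h1
    exact self_eq_neg.1 h1
  have hlg0 : logDeriv g 0 = 0 := by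
    rw [hld 0 h0, hsum0, logDeriv_apply, deriv_zero_of_even he]
    simp
  rw [← hld w hfw]
  exact norm_logDeriv_le_of_norm_le hR (by positivity) hg hZne hgb hlg0 hw

theorem finite_zeros_inter_closedBall {f : ℂ → ℂ} (hf : Differentiable ℂ f) {b : ℂ} (hb : f b ≠ 0)
    (R : ℝ) : {z | f z = 0 ∧ ‖z‖ ≤ R}.Finite := by
  by_contra hinf
  obtain ⟨a, -, ha⟩ := Set.Infinite.exists_accPt_of_subset_isCompact hinf
    (isCompact_closedBall (0 : ℂ) R) (fun z hz ↦ by simpa using hz.2)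
  have h1 : Set.EqOn f 0 Set.univ :=
    (hf.differentiableOn.analyticOnNhd isOpen_univ).eqOn_zero_of_preconnected_of_frequently_eq_zero
      isPreconnected_univ (Set.mem_univ a)
      ((accPt_iff_frequently_nhdsNE.1 ha).mono fun z hz ↦ hz.1)
  exact hb (h1 (Set.mem_univ b))

/-- **Partial fractions of the logarithmic derivative** of an even entire function of growth
`exp(o(|z|²))`. -/
theorem tendsto_sum_div_sub_logDeriv {f : ℂ → ℂ} (hf : Differentiable ℂ f)
    (he : ∀ z, f (-z) = f z) (h0 : f 0 ≠ 0) {M : ℕ → ℝ} (hM : ∀ n, 0 < M n)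
    (hb : ∀ (n : ℕ) (z : ℂ), ‖z‖ ≤ 2 * n → ‖f z‖ ≤ Real.exp (M n))
    (hlim : Tendsto (fun n ↦ M n / (n : ℝ) ^ 2) atTop (𝓝 0)) {Z : ℕ → Finset ℂ}
    (hZ : ∀ n z, z ∈ Z n ↔ f z = 0 ∧ ‖z‖ ≤ n) {w : ℂ} (hfw : f w ≠ 0) :
    Tendsto (fun n ↦ ∑ a ∈ Z n, (analyticOrderNatAt f a : ℂ) / (w - a)) atTop
      (𝓝 (logDeriv f w)) := by
  have hinv : Tendsto (fun n : ℕ ↦ (1 / n : ℝ)) atTop (𝓝 0) := tendsto_one_div_atTop_nhds_zero_nat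
  have hbound : Tendsto (fun n : ℕ ↦ 32 * (M n + |Real.log ‖f 0‖|) / (n : ℝ) ^ 2 * ‖w‖) atTop
      (𝓝 0) := by
    have := ((hlim.add ((hinv.mul hinv).const_mul |Real.log ‖f 0‖|)).const_mul 32).mul_const ‖w‖
    simp only [mul_zero, add_zero, zero_mul] at this
    refine this.congr fun n ↦ ?_
    ring
  rw [tendsto_iff_norm_sub_tendsto_zero]
  refine squeeze_zero' (Eventually.of_forall fun n ↦ norm_nonneg _) ?_ hbound
  filter_upwards [eventually_gt_atTop 0,
    tendsto_natCast_atTop_atTop.eventually_gt_atTop (4 * ‖w‖)] with n hn hwn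
  rw [norm_sub_rev]
  exact norm_logDeriv_sub_sum_le (by exact_mod_cast hn) (hM n) hf he h0 (hb n) (hZ n)
    (by linarith) hfw

/-! ### Sums over the nontrivial zeros and the partial fractions of ξ'/ξ -/

theorem one_sub_mem_zetaZeros {ρ : ℂ} (h : ρ ∈ zetaZeros) : 1 - ρ ∈ zetaZeros := by
  rw [← xi_eq_zero_iff, xi_one_sub, xi_eq_zero_iff]
  exact h

/-- The symmetry `ρ ↦ 1 - ρ` of the nontrivial zeros. -/
def zetaZerosOneSub : zetaZeros ≃ zetaZeros where
  toFun ρ := ⟨1 - ρ, one_sub_mem_zetaZeros ρ.2⟩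
  invFun ρ := ⟨1 - ρ, one_sub_mem_zetaZeros ρ.2⟩
  left_inv ρ := by simp
  right_inv ρ := by simp

theorem coe_zetaZerosOneSub (ρ : zetaZeros) : (zetaZerosOneSub ρ : ℂ) = 1 - ρ := rfl

/-- The multiplicity of a nontrivial zero. -/
noncomputable abbrev zetaMult (ρ : zetaZeros) : ℕ := analyticOrderNatAt riemannZeta (ρ : ℂ)

/-- Near ρ the quotient ξ/ζ = s(s-1)Γℝ(s) is analytic and nonzero. -/
theorem analyticOrderNatAt_xi (ρ : zetaZeros) : analyticOrderNatAt xi ρ = zetaMult ρ := by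
  obtain ⟨ρ, h0, h1, h⟩ := ρ
  have hρ1 : ρ ≠ 1 := by rintro rfl; simp at h1
  have hρ0 : ρ ≠ 0 := by rintro rfl; simp at h0
  have hU : IsOpen {s : ℂ | 0 < s.re} := isOpen_lt continuous_const Complex.continuous_re
  have hd : ∀ s ∈ {s : ℂ | 0 < s.re}, DifferentiableAt ℂ Complex.Gammaℝ s := by
    intro s hs
    have h2 : DifferentiableAt ℂ Complex.Gamma (s / 2) :=
      Complex.differentiableAt_Gamma _ fun m hm ↦ by
        have h3 := congrArg Complex.re hm
        have h4 : (s / 2).re = s.re / 2 := by simp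
        rw [h4] at h3
        have h5 : 0 < s.re := hs
        simp at h3
        linarith [(m.cast_nonneg : (0 : ℝ) ≤ m)]
    have h3 : Complex.Gammaℝ = fun s : ℂ ↦ (Real.pi : ℂ) ^ (-s / 2) * Complex.Gamma (s / 2) :=
      funext fun s ↦ Complex.Gammaℝ_def s
    rw [h3]
    refine DifferentiableAt.mul ?_ (h2.comp s (by fun_prop))
    exact DifferentiableAt.const_cpow (by fun_prop) (Or.inl (by simp [Real.pi_ne_zero]))
  have hG : AnalyticAt ℂ (fun s ↦ s * (s - 1) * Complex.Gammaℝ s) ρ := by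
    refine DifferentiableOn.analyticAt (s := {s : ℂ | 0 < s.re}) (fun s hs ↦ ?_) (hU.mem_nhds h0)
    exact (DifferentiableAt.mul (by fun_prop) (hd s hs)).differentiableWithinAt
  have hζ : AnalyticAt ℂ riemannZeta ρ := analyticOn_riemannZeta ρ hρ1
  have hne : ρ * (ρ - 1) * Complex.Gammaℝ ρ ≠ 0 :=
    mul_ne_zero (mul_ne_zero hρ0 (sub_ne_zero.2 hρ1)) (Complex.Gammaℝ_ne_zero_of_re_pos h0)
  have hxi : xi =ᶠ[𝓝 ρ] (fun s ↦ s * (s - 1) * Complex.Gammaℝ s) * riemannZeta := by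
    filter_upwards [hU.mem_nhds h0, isOpen_ne.mem_nhds hρ1] with s hs hs1
    exact xi_eq_mul_riemannZeta hs hs1
  rw [zetaMult, analyticOrderNatAt, analyticOrderNatAt, analyticOrderAt_congr hxi,
    analyticOrderAt_mul hG hζ, hG.analyticOrderAt_eq_zero.2 hne, zero_add]

theorem analyticOrderNatAt_xi_add (w : ℂ) :
    analyticOrderNatAt (fun w ↦ xi (1 / 2 + w)) w = analyticOrderNatAt xi (1 / 2 + w) := by
  have := analyticOrderAt_comp_of_deriv_ne_zero (f := xi) (g := fun w : ℂ ↦ 1 / 2 + w) (z₀ := w)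
    (by fun_prop) (by simp)
  rw [analyticOrderNatAt, analyticOrderNatAt, ← this]
  rfl

theorem xi_half_add_neg (w : ℂ) : xi (1 / 2 + -w) = xi (1 / 2 + w) := by
  rw [← xi_one_sub]; congr 1; ring

theorem zetaMult_oneSub (ρ : zetaZeros) : zetaMult (zetaZerosOneSub ρ) = zetaMult ρ := by
  rw [← analyticOrderNatAt_xi, ← analyticOrderNatAt_xi, coe_zetaZerosOneSub]
  have h1 := analyticOrderNatAt_neg_of_even (f := fun w ↦ xi (1 / 2 + w)) xi_half_add_neg (ρ - 1 / 2)
  rw [analyticOrderNatAt_xi_add, analyticOrderNatAt_xi_add] at h1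
  rwa [show (1 / 2 + -((ρ : ℂ) - 1 / 2)) = 1 - ρ by ring,
    show (1 / 2 + ((ρ : ℂ) - 1 / 2)) = ρ by ring] at h1

theorem xi_half_add_zero_ne_zero : xi (1 / 2 + 0) ≠ 0 := by
  have := xi_ofReal_ne_zero (1 / 2)
  push_cast at this
  rwa [add_zero]

theorem differentiable_xi_half_add : Differentiable ℂ fun w ↦ xi (1 / 2 + w) :=
  differentiable_xi.comp (by fun_prop)

theorem finite_zetaZeros_norm_le (R : ℝ) : {ρ : zetaZeros | ‖(ρ : ℂ) - 1 / 2‖ ≤ R}.Finite := by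
  have h := finite_zeros_inter_closedBall differentiable_xi_half_add xi_half_add_zero_ne_zero R
  refine Set.Finite.of_finite_image (f := fun ρ : zetaZeros ↦ (ρ : ℂ) - 1 / 2)
    (h.subset ?_) (fun a _ b _ hab ↦ Subtype.ext (sub_left_injective hab))
  rintro _ ⟨ρ, hρ, rfl⟩
  refine ⟨?_, hρ⟩
  rw [add_sub_cancel]
  exact xi_eq_zero_iff.2 ρ.2

/-- The nontrivial zeros at distance at most `n` from `1 / 2`. -/
noncomputable def zetaZerosFinset (n : ℕ) : Finset zetaZeros := (finite_zetaZeros_norm_le n).toFinset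

theorem mem_zetaZerosFinset {n : ℕ} {ρ : zetaZeros} :
    ρ ∈ zetaZerosFinset n ↔ ‖(ρ : ℂ) - 1 / 2‖ ≤ n := by simp [zetaZerosFinset]

theorem tendsto_zetaZerosFinset : Tendsto zetaZerosFinset atTop atTop := by
  refine tendsto_atTop_finset_of_monotone (fun m n hmn ρ h ↦ ?_) fun ρ ↦ ?_
  · rw [mem_zetaZerosFinset] at h ⊢
    exact h.trans (by exact_mod_cast hmn)
  · obtain ⟨n, hn⟩ := exists_nat_ge ‖(ρ : ℂ) - 1 / 2‖
    exact ⟨n, mem_zetaZerosFinset.2 hn⟩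

theorem logDeriv_xi_half_add (w : ℂ) :
    logDeriv (fun w ↦ xi (1 / 2 + w)) w = logDeriv xi (1 / 2 + w) := by
  rw [logDeriv_apply, logDeriv_apply, deriv_comp_const_add]

theorem tendsto_sum_zetaZerosFinset {s : ℂ} (hs : xi s ≠ 0) :
    Tendsto (fun n ↦ ∑ ρ ∈ zetaZerosFinset n, (zetaMult ρ : ℂ) / (s - ρ)) atTop
      (𝓝 (logDeriv xi s)) := by
  obtain ⟨M, hM, hb, hlim⟩ := exists_growth_xi
  let e : zetaZeros ↪ ℂ := ⟨fun ρ ↦ (ρ : ℂ) - 1 / 2,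
    fun a b hab ↦ Subtype.ext (sub_left_injective hab)⟩
  have h := tendsto_sum_div_sub_logDeriv differentiable_xi_half_add xi_half_add_neg
    xi_half_add_zero_ne_zero hM hb hlim (Z := fun n ↦ (zetaZerosFinset n).map e) (w := s - 1 / 2)
    (fun n z ↦ by
      rw [Finset.mem_map]
      constructor
      · rintro ⟨ρ, hρ, rfl⟩
        refine ⟨?_, mem_zetaZerosFinset.1 hρ⟩
        change xi (1 / 2 + ((ρ : ℂ) - 1 / 2)) = 0
        rw [add_sub_cancel]
        exact xi_eq_zero_iff.2 ρ.2
      · rintro ⟨hz, hn⟩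
        exact ⟨⟨1 / 2 + z, xi_eq_zero_iff.1 hz⟩, mem_zetaZerosFinset.2 (by simpa using hn),
          by simp [e]⟩)
    (by rwa [add_sub_cancel])
  rw [logDeriv_xi_half_add, add_sub_cancel] at h
  refine h.congr fun n ↦ ?_
  rw [Finset.sum_map]
  refine Finset.sum_congr rfl fun ρ _ ↦ ?_
  have he : e ρ = (ρ : ℂ) - 1 / 2 := rfl
  rw [analyticOrderNatAt_xi_add, he, add_sub_cancel, analyticOrderNatAt_xi,
    sub_sub_sub_cancel_right]

/-- Re 1/(2 - ρ) = (2 - Re ρ)/|ρ - 2|² ≥ 1/|ρ - 2|² because Re ρ < 1. The truncated sums of the left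
side converge to Re ξ'/ξ(2), hence bound all finite sums of the right side. -/
theorem summable_zetaMult_mul_norm_sq_two :
    Summable fun ρ : zetaZeros ↦ (zetaMult ρ : ℝ) * ‖((ρ : ℂ) - 2)⁻¹‖ ^ 2 := by
  have hxi : xi 2 ≠ 0 := by exact_mod_cast xi_ofReal_ne_zero 2
  have h := (Complex.continuous_re.tendsto _).comp (tendsto_sum_zetaZerosFinset hxi)
  obtain ⟨B, hB⟩ := h.bddAbove_range
  refine summable_of_sum_le (c := B) (fun ρ ↦ by positivity) fun u ↦ ?_
  obtain ⟨n, hn⟩ := (tendsto_zetaZerosFinset.eventually_ge_atTop u).exists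
  refine le_trans ?_ (hB ⟨n, rfl⟩)
  refine (Finset.sum_le_sum_of_subset_of_nonneg hn fun ρ _ _ ↦ by positivity).trans ?_
  simp only [Function.comp_apply, Complex.re_sum]
  refine Finset.sum_le_sum fun ρ _ ↦ ?_
  obtain ⟨h0, h1, -⟩ := ρ.2
  have hre : ((zetaMult ρ : ℂ) / (2 - ρ)).re =
      (zetaMult ρ : ℝ) * ((2 - (ρ : ℂ).re) * ‖((ρ : ℂ) - 2)⁻¹‖ ^ 2) := by
    rw [div_eq_mul_inv, ← Complex.ofReal_natCast, Complex.re_ofReal_mul, Complex.inv_re, norm_inv,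
      inv_pow, Complex.sq_norm, ← Complex.normSq_neg, neg_sub]
    simp [div_eq_mul_inv]
  rw [hre]
  refine mul_le_mul_of_nonneg_left ?_ (by positivity)
  exact le_mul_of_one_le_left (by positivity) (by linarith)

theorem tendsto_norm_zetaZeros_sub (a : ℂ) :
    Tendsto (fun ρ : zetaZeros ↦ ‖(ρ : ℂ) - a‖) cofinite atTop := by
  refine tendsto_atTop.2 fun B ↦ ?_
  refine ((finite_zetaZeros_norm_le (B + ‖a - 1 / 2‖)).subset fun ρ hρ ↦ ?_)
  have hρ' : ‖(ρ : ℂ) - a‖ < B := by simpa using hρ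
  calc ‖(ρ : ℂ) - 1 / 2‖ = ‖((ρ : ℂ) - a) + (a - 1 / 2)‖ := by congr 1; ring
    _ ≤ _ := (norm_add_le _ _).trans (by linarith)

theorem tendsto_norm_inv_zetaZeros_sub (a : ℂ) :
    Tendsto (fun ρ : zetaZeros ↦ ‖((ρ : ℂ) - a)⁻¹‖) cofinite (𝓝 0) := by
  simp only [norm_inv]
  exact (tendsto_norm_zetaZeros_sub a).inv_tendsto_atTop

theorem summable_zetaMult_mul_norm_sq (a : ℂ) :
    Summable fun ρ : zetaZeros ↦ (zetaMult ρ : ℝ) * ‖((ρ : ℂ) - a)⁻¹‖ ^ 2 := by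
  refine (summable_zetaMult_mul_norm_sq_two.mul_left 4).of_norm_bounded_eventually ?_
  filter_upwards [(tendsto_norm_zetaZeros_sub a).eventually_ge_atTop (‖a - 2‖ + 1),
    (tendsto_norm_zetaZeros_sub 2).eventually_gt_atTop 0] with ρ h1 h2
  rw [Real.norm_of_nonneg (by positivity), mul_left_comm]
  gcongr
  have h3 : ‖(ρ : ℂ) - 2‖ ≤ 2 * ‖(ρ : ℂ) - a‖ := by
    calc ‖(ρ : ℂ) - 2‖ = ‖((ρ : ℂ) - a) + (a - 2)‖ := by congr 1; ring
      _ ≤ _ := (norm_add_le _ _).trans (by linarith)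
  have h4 : ‖((ρ : ℂ) - a)⁻¹‖ ≤ 2 * ‖((ρ : ℂ) - 2)⁻¹‖ := by
    have h5 : 0 < ‖(ρ : ℂ) - a‖ := by linarith [norm_nonneg (a - 2)]
    rw [norm_inv, norm_inv, inv_le_iff_one_le_mul₀ h5]
    field_simp
    linarith
  calc ‖((ρ : ℂ) - a)⁻¹‖ ^ 2 ≤ (2 * ‖((ρ : ℂ) - 2)⁻¹‖) ^ 2 := by gcongr
    _ = _ := by ring

theorem summable_zetaMult_mul_norm_sq_oneSub (a : ℂ) :
    Summable fun ρ : zetaZeros ↦ (zetaMult ρ : ℝ) * ‖(1 - (ρ : ℂ) - a)⁻¹‖ ^ 2 := by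
  have h := zetaZerosOneSub.summable_iff.2 (summable_zetaMult_mul_norm_sq a)
  refine h.congr fun ρ ↦ ?_
  simp only [Function.comp_apply, zetaMult_oneSub, coe_zetaZerosOneSub]

theorem sub_ne_zero_of_mem_zetaZeros {a : ℂ} (ha : xi a ≠ 0) {ρ : ℂ} (hρ : ρ ∈ zetaZeros) :
    ρ - a ≠ 0 := sub_ne_zero.2 (by rintro rfl; exact ha (xi_eq_zero_iff.2 hρ))

/-- Pairing replaces first-order decay by second-order: the two fractions add up to (1 - 2a)/((ρ -
a)(1 - ρ - a)). -/
theorem summable_zetaMult_mul_norm_add {a : ℂ} (ha : xi a ≠ 0) :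
    Summable fun ρ : zetaZeros ↦
      (zetaMult ρ : ℝ) * ‖((ρ : ℂ) - a)⁻¹ + (1 - (ρ : ℂ) - a)⁻¹‖ := by
  refine (((summable_zetaMult_mul_norm_sq a).add
    (summable_zetaMult_mul_norm_sq_oneSub a)).mul_left ‖1 - 2 * a‖).of_nonneg_of_le
    (fun ρ ↦ by positivity) fun ρ ↦ ?_
  have h1 := sub_ne_zero_of_mem_zetaZeros ha ρ.2
  have h2 := sub_ne_zero_of_mem_zetaZeros ha (one_sub_mem_zetaZeros ρ.2)
  have h3 : ((ρ : ℂ) - a)⁻¹ + (1 - (ρ : ℂ) - a)⁻¹ =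
      (1 - 2 * a) * (((ρ : ℂ) - a)⁻¹ * (1 - (ρ : ℂ) - a)⁻¹) := by
    field_simp
    ring
  rw [h3, norm_mul, norm_mul, mul_left_comm, ← mul_add]
  gcongr
  nlinarith [sq_nonneg (‖((ρ : ℂ) - a)⁻¹‖ - ‖(1 - (ρ : ℂ) - a)⁻¹‖),
    sq_nonneg ‖((ρ : ℂ) - a)⁻¹‖, sq_nonneg ‖(1 - (ρ : ℂ) - a)⁻¹‖]

/-- The expansion of `ξ'/ξ` in partial fractions, the zeros `ρ` and `1 - ρ` being paired. -/
theorem hasSum_logDeriv_xi {s : ℂ} (hs : xi s ≠ 0) :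
    HasSum (fun ρ : zetaZeros ↦
      (zetaMult ρ : ℂ) * ((((ρ : ℂ) - s)⁻¹ + (1 - (ρ : ℂ) - s)⁻¹) / 2)) (-logDeriv xi s) := by
  have hsum : Summable fun ρ : zetaZeros ↦
      (zetaMult ρ : ℂ) * ((((ρ : ℂ) - s)⁻¹ + (1 - (ρ : ℂ) - s)⁻¹) / 2) := by
    refine Summable.of_norm_bounded (summable_zetaMult_mul_norm_add hs) fun ρ ↦ ?_
    rw [norm_mul, norm_div, Complex.norm_natCast, Complex.norm_ofNat]
    gcongr
    linarith [norm_nonneg (((ρ : ℂ) - s)⁻¹ + (1 - (ρ : ℂ) - s)⁻¹)]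
  have h1 := hsum.hasSum.comp tendsto_zetaZerosFinset
  have h2 : Tendsto (fun n ↦ ∑ ρ ∈ zetaZerosFinset n,
      (zetaMult ρ : ℂ) * ((((ρ : ℂ) - s)⁻¹ + (1 - (ρ : ℂ) - s)⁻¹) / 2)) atTop
      (𝓝 (-logDeriv xi s)) := by
    refine (tendsto_sum_zetaZerosFinset hs).neg.congr fun n ↦ ?_
    -- The truncation |ρ - 1/2| ≤ n is symmetric under ρ ↦ 1 - ρ, so truncated unpaired and paired
    -- sums agree.
    have h3 : ∑ ρ ∈ zetaZerosFinset n, (zetaMult ρ : ℂ) * ((ρ : ℂ) - s)⁻¹ =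
        ∑ ρ ∈ zetaZerosFinset n, (zetaMult ρ : ℂ) * (1 - (ρ : ℂ) - s)⁻¹ := by
      refine Finset.sum_equiv zetaZerosOneSub (fun ρ ↦ ?_) fun ρ _ ↦ ?_
      · rw [mem_zetaZerosFinset, mem_zetaZerosFinset, coe_zetaZerosOneSub, ← norm_neg]
        congr! 2
        ring
      · rw [zetaMult_oneSub, coe_zetaZerosOneSub, sub_sub_cancel]
    have h4 : ∑ ρ ∈ zetaZerosFinset n, (zetaMult ρ : ℂ) / (s - ρ) =
        -∑ ρ ∈ zetaZerosFinset n, (zetaMult ρ : ℂ) * ((ρ : ℂ) - s)⁻¹ := by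
      rw [← Finset.sum_neg_distrib]
      refine Finset.sum_congr rfl fun ρ _ ↦ ?_
      rw [← neg_sub, div_neg, div_eq_mul_inv]
    have h5 : ∑ ρ ∈ zetaZerosFinset n,
        (zetaMult ρ : ℂ) * ((((ρ : ℂ) - s)⁻¹ + (1 - (ρ : ℂ) - s)⁻¹) / 2) =
        (∑ ρ ∈ zetaZerosFinset n, (zetaMult ρ : ℂ) * ((ρ : ℂ) - s)⁻¹ +
          ∑ ρ ∈ zetaZerosFinset n, (zetaMult ρ : ℂ) * (1 - (ρ : ℂ) - s)⁻¹) / 2 := by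
      rw [← Finset.sum_add_distrib, Finset.sum_div]
      exact Finset.sum_congr rfl fun ρ _ ↦ by ring
    rw [h4, h5, ← h3]
    ring
  rw [← tendsto_nhds_unique h1 h2]
  exact hsum.hasSum

/-! ### Power sums over the zeros and the Taylor coefficients of ξ'/ξ -/

/-- The sum of `(ρ - a)⁻¹ ^ (k + 1)` over the nontrivial zeros, `ρ` and `1 - ρ` being paired. -/
noncomputable def zetaZeroPowerSum (k : ℕ) (a : ℂ) : ℂ :=
  ∑' ρ : zetaZeros, (zetaMult ρ : ℂ) *
    ((((ρ : ℂ) - a)⁻¹ ^ (k + 1) + (1 - (ρ : ℂ) - a)⁻¹ ^ (k + 1)) / 2)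

/-- A majorant that separates k from the zero. Cancellation within the pair is needed only for k =
0; for k ≥ 1 the squares suffice. -/
theorem norm_pow_succ_add_pow_succ_le {u v : ℂ} {K : ℝ} (hK : 0 < K) (hu : ‖u‖ ≤ K) (hv : ‖v‖ ≤ K)
    (k : ℕ) : ‖(u ^ (k + 1) + v ^ (k + 1)) / 2‖ ≤
      (‖u + v‖ + (‖u‖ ^ 2 + ‖v‖ ^ 2) / K) * K ^ k := by
  have key : ∀ {w : ℂ}, ‖w‖ ≤ K → ∀ j : ℕ, ‖w ^ (j + 1 + 1)‖ ≤ ‖w‖ ^ 2 / K * K ^ (j + 1) := by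
    intro w hw j
    rw [norm_pow, show j + 1 + 1 = 2 + j by ring, pow_add, pow_succ K j]
    calc ‖w‖ ^ 2 * ‖w‖ ^ j ≤ ‖w‖ ^ 2 * K ^ j := by gcongr
      _ = _ := by field_simp
  rw [norm_div, Complex.norm_ofNat]
  rcases k with _ | j
  · have h1 : 0 ≤ (‖u‖ ^ 2 + ‖v‖ ^ 2) / K := by positivity
    simp only [zero_add, pow_one, pow_zero, mul_one]
    linarith [norm_nonneg (u + v)]
  · have h1 := (norm_add_le _ _).trans (add_le_add (key hu j) (key hv j))
    have h2 : 0 ≤ ‖u + v‖ * K ^ (j + 1) := by positivity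
    have h3 := norm_nonneg (u ^ (j + 1 + 1) + v ^ (j + 1 + 1))
    rw [add_mul, add_div, add_mul]
    linarith

/-- Interchange of the summations over `k` and over the nontrivial zeros. -/
theorem hasSum_mul_zetaZeroPowerSum {a : ℂ} (ha : xi a ≠ 0) {K : ℝ} (hK : 0 < K)
    (hv : ∀ ρ ∈ zetaZeros, ‖(ρ - a)⁻¹‖ ≤ K) {c : ℕ → ℂ} (hc : Summable fun k ↦ ‖c k‖ * K ^ k)
    {φ : ℂ → ℂ} (hφ : ∀ ρ ∈ zetaZeros, HasSum (fun k ↦ c k * (ρ - a)⁻¹ ^ (k + 1)) (φ ρ)) :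
    HasSum (fun k ↦ c k * zetaZeroPowerSum k a)
      (∑' ρ : zetaZeros, (zetaMult ρ : ℂ) * ((φ ρ + φ (1 - ρ)) / 2)) := by
  set A : zetaZeros → ℝ := fun ρ ↦ (zetaMult ρ : ℝ) * (‖((ρ : ℂ) - a)⁻¹ + (1 - (ρ : ℂ) - a)⁻¹‖ +
    (‖((ρ : ℂ) - a)⁻¹‖ ^ 2 + ‖(1 - (ρ : ℂ) - a)⁻¹‖ ^ 2) / K) with hA
  have hAsum : Summable A := by
    refine ((summable_zetaMult_mul_norm_add ha).add (((summable_zetaMult_mul_norm_sq a).add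
      (summable_zetaMult_mul_norm_sq_oneSub a)).div_const K)).congr fun ρ ↦ ?_
    simp only [hA]
    ring
  set t : ℕ × zetaZeros → ℂ := fun p ↦ c p.1 * ((zetaMult p.2 : ℂ) *
    ((((p.2 : ℂ) - a)⁻¹ ^ (p.1 + 1) + (1 - (p.2 : ℂ) - a)⁻¹ ^ (p.1 + 1)) / 2)) with ht
  have hle : ∀ p, ‖t p‖ ≤ (‖c p.1‖ * K ^ p.1) * A p.2 := by
    rintro ⟨k, ρ⟩
    have h1 := norm_pow_succ_add_pow_succ_le hK (hv ρ ρ.2) (hv _ (one_sub_mem_zetaZeros ρ.2)) k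
    simp only [ht, hA]
    rw [norm_mul, norm_mul, Complex.norm_natCast]
    calc _ ≤ ‖c k‖ * ((zetaMult ρ : ℝ) * ((‖((ρ : ℂ) - a)⁻¹ + (1 - (ρ : ℂ) - a)⁻¹‖ +
        (‖((ρ : ℂ) - a)⁻¹‖ ^ 2 + ‖(1 - (ρ : ℂ) - a)⁻¹‖ ^ 2) / K) * K ^ k)) := by gcongr
      _ = _ := by ring
  have htsum : Summable t := Summable.of_norm_bounded
    (hc.mul_of_nonneg hAsum (fun k ↦ by positivity) (fun ρ ↦ by positivity)) hle
  have h1 : HasSum (fun k ↦ c k * zetaZeroPowerSum k a) (∑' p, t p) := by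
    refine htsum.hasSum.prod_fiberwise fun k ↦ ?_
    have h2 := (htsum.prod_factor k).hasSum
    simp only [ht, tsum_mul_left] at h2 ⊢
    exact h2
  have h3 : HasSum (fun ρ : zetaZeros ↦ (zetaMult ρ : ℂ) * ((φ ρ + φ (1 - ρ)) / 2))
      (∑' p, t p) := by
    have h4 : HasSum (fun p : zetaZeros × ℕ ↦ t p.swap) (∑' p, t p) :=
      (Equiv.prodComm zetaZeros ℕ).hasSum_iff.2 htsum.hasSum
    refine h4.prod_fiberwise fun ρ ↦ ?_
    have h5 := (((hφ ρ ρ.2).add (hφ _ (one_sub_mem_zetaZeros ρ.2))).div_const 2).mul_left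
      (zetaMult ρ : ℂ)
    refine h5.congr_fun fun k ↦ ?_
    simp only [ht, Prod.swap]
    ring
  rw [h3.tsum_eq]
  exact h1

theorem exists_norm_inv_zetaZeros_sub_le (a : ℂ) :
    ∃ K : ℝ, 0 < K ∧ ∀ ρ ∈ zetaZeros, ‖(ρ - a)⁻¹‖ ≤ K := by
  obtain ⟨B, hB⟩ := (tendsto_norm_inv_zetaZeros_sub a).bddAbove_range_of_cofinite
  exact ⟨max B 1, by positivity, fun ρ hρ ↦ (hB ⟨⟨ρ, hρ⟩, rfl⟩).trans (le_max_left _ _)⟩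

/-- All but finitely many values lie below B/2, so a maximum over finitely many indices remains.
This makes |τ| < |ρ - τ| uniform in ρ. -/
theorem exists_lt_forall_le_of_tendsto_cofinite {ι : Type*} {f : ι → ℝ}
    (hf : Tendsto f cofinite (𝓝 0)) {B : ℝ} (hB : 0 < B) (h : ∀ i, f i < B) :
    ∃ K : ℝ, 0 < K ∧ K < B ∧ ∀ i, f i ≤ K := by
  have hfin : {i | ¬ f i < B / 2}.Finite := hf.eventually_lt_const (half_pos hB)
  have key : ∀ s : Finset ι, ∃ K, B / 2 ≤ K ∧ K < B ∧ ∀ i ∈ s, f i ≤ K := by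
    classical
    intro s
    induction s using Finset.induction_on with
    | empty => exact ⟨B / 2, le_rfl, by linarith, by simp⟩
    | insert a s _ ih =>
      obtain ⟨K, h1, h2, h3⟩ := ih
      refine ⟨max K (f a), h1.trans (le_max_left _ _), max_lt h2 (h a), fun i hi ↦ ?_⟩
      rcases Finset.mem_insert.1 hi with rfl | hi
      · exact le_max_right _ _
      · exact (h3 i hi).trans (le_max_left _ _)
  obtain ⟨K, h1, h2, h3⟩ := key hfin.toFinset
  refine ⟨K, by linarith, h2, fun i ↦ ?_⟩
  by_cases hi : f i < B / 2
  · linarith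
  · exact h3 i (by simpa using hi)

theorem iteratedDeriv_logDeriv_xi {a : ℂ} (ha : xi a ≠ 0) (k : ℕ) :
    iteratedDeriv k (logDeriv xi) a = -(k.factorial : ℂ) * zetaZeroPowerSum k a := by
  obtain ⟨K, hK, hv⟩ := exists_norm_inv_zetaZeros_sub_le a
  have hps : HasFPowerSeriesAt (logDeriv xi)
      (FormalMultilinearSeries.ofScalars ℂ fun k ↦ -zetaZeroPowerSum k a) a := by
    rw [hasFPowerSeriesAt_iff]
    have h1 : ∀ᶠ z : ℂ in 𝓝 0, ‖z‖ * K < 1 := by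
      have : Tendsto (fun z : ℂ ↦ ‖z‖ * K) (𝓝 0) (𝓝 (‖(0 : ℂ)‖ * K)) :=
        (continuous_norm.mul continuous_const).tendsto 0
      rw [norm_zero, zero_mul] at this
      exact this.eventually_lt_const one_pos
    have h2 : ∀ᶠ z : ℂ in 𝓝 0, xi (a + z) ≠ 0 := by
      have : Tendsto (fun z ↦ xi (a + z)) (𝓝 0) (𝓝 (xi (a + 0))) :=
        (differentiable_xi.continuous.comp (continuous_const.add continuous_id)).tendsto 0
      rw [add_zero] at this
      exact this.eventually_ne ha
    filter_upwards [h1, h2] with z hz hxi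
    have hc : Summable fun k : ℕ ↦ ‖z ^ k‖ * K ^ k := by
      simp only [norm_pow, ← mul_pow]
      exact summable_geometric_of_lt_one (by positivity) hz
    -- The interchange with cₖ = z^k: the geometric series of 1/(ρ - a - z) sums to the partial
    -- fractions at a + z, giving the Taylor series of ξ'/ξ at a.
    have h3 := hasSum_mul_zetaZeroPowerSum ha hK hv hc (φ := fun ρ ↦ (ρ - (a + z))⁻¹)
      fun ρ hρ ↦ by
        have hρa := sub_ne_zero_of_mem_zetaZeros ha hρ
        have hρz := sub_ne_zero_of_mem_zetaZeros hxi hρ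
        have hlt : ‖z * (ρ - a)⁻¹‖ < 1 := by
          rw [norm_mul]
          exact (mul_le_mul_of_nonneg_left (hv ρ hρ) (norm_nonneg z)).trans_lt hz
        have h4 := (hasSum_geometric_of_norm_lt_one hlt).mul_right (ρ - a)⁻¹
        have h5 : (1 - z * (ρ - a)⁻¹)⁻¹ * (ρ - a)⁻¹ = (ρ - (a + z))⁻¹ := by
          rw [← mul_inv, sub_mul, mul_assoc, inv_mul_cancel₀ hρa]
          congr 1
          ring
        rw [h5] at h4
        exact h4.congr_fun fun k ↦ by ring
    rw [(hasSum_logDeriv_xi hxi).tsum_eq] at h3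
    have h6 := h3.neg
    rw [neg_neg] at h6
    refine h6.congr_fun fun k ↦ ?_
    rw [FormalMultilinearSeries.coeff_ofScalars, smul_eq_mul]
    ring
  have h7 := hps.eq_formalMultilinearSeries hps.analyticAt.hasFPowerSeriesAt
  have h8 := congrArg (fun p ↦ FormalMultilinearSeries.coeff p k) h7
  simp only [FormalMultilinearSeries.coeff_ofScalars] at h8
  rw [eq_div_iff (by exact_mod_cast k.factorial_ne_zero)] at h8
  rw [← h8]
  ring

theorem ell_eq_neg_zetaZeroPowerSum (k : ℕ) (τ : ℝ) : ell k τ = -zetaZeroPowerSum k τ := by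
  have h := iteratedDeriv_logDeriv_xi (xi_ofReal_ne_zero τ) k
  have hk : (k.factorial : ℂ) ≠ 0 := by exact_mod_cast k.factorial_ne_zero
  rw [ell, show (fun s : ℂ ↦ deriv xi s / xi s) = logDeriv xi from rfl, h]
  field_simp

/-! ### Gamma quotients and binomial series -/

theorem choose_succ_mul_factorial (x : ℂ) (k : ℕ) :
    ((k + 1).factorial : ℂ) * Ring.choose x (k + 1) = ∏ j ∈ Finset.range (k + 1), (x - j) := by
  rw [← nsmul_eq_mul, ← Ring.descPochhammer_eq_factorial_smul_choose]
  generalize k + 1 = n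
  induction n with
  | zero => simp
  | succ n ih =>
    rw [Finset.prod_range_succ, ← ih, descPochhammer_succ_right, Polynomial.smeval_mul]
    simp [Polynomial.smeval_natCast]

theorem gammaQuot_eq_prod (x : ℂ) (k : ℕ) : gammaQuot x k = ∏ j ∈ Finset.range (k + 1), (x - j) := by
  rw [gammaQuot]
  split_ifs with h
  · rfl
  have hx : ∀ m : ℕ, x ≠ -((m : ℂ) + 1) := fun m hm ↦ h ⟨m, hm⟩
  induction k with
  | zero =>
    rcases eq_or_ne x 0 with rfl | hx0
    · simp
    · have hG : Complex.Gamma x ≠ 0 := Complex.Gamma_ne_zero fun m hm ↦ by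
        rcases m with _ | m
        · exact hx0 (by simpa using hm)
        · exact hx m (by simpa using hm)
      rw [Complex.Gamma_add_one x hx0]
      simp [hG]
  | succ k ih =>
    rw [Finset.prod_range_succ, ← ih]
    -- At x = k + 1 the product has a zero factor, and the quotient is 0 because `Complex.Gamma 0 =
    -- 0` and division by zero gives 0.
    rcases eq_or_ne (x - ((k + 1 : ℕ) : ℂ)) 0 with h0 | h0
    · rw [h0, Complex.Gamma_zero]
      simp
    · have h1 : x - (k : ℂ) = x - ((k + 1 : ℕ) : ℂ) + 1 := by push_cast; ring
      rw [h1, Complex.Gamma_add_one _ h0]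
      field_simp

theorem gammaQuot_div_factorial (x : ℂ) (k : ℕ) :
    gammaQuot x k / ((k + 1).factorial : ℂ) = Ring.choose x (k + 1) := by
  rw [gammaQuot_eq_prod, ← choose_succ_mul_factorial,
    mul_div_cancel_left₀ _ (by exact_mod_cast (k + 1).factorial_ne_zero)]

theorem hasSum_choose_mul_pow (x : ℂ) {u : ℂ} (hu : ‖u‖ < 1) :
    HasSum (fun k : ℕ ↦ Ring.choose x k * u ^ k) ((1 + u) ^ x) := by
  have h := (Complex.one_add_cpow_hasFPowerSeriesOnBall_zero (a := x)).hasSum (y := u) (by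
    rw [← ENNReal.ofReal_one, Metric.eball_ofReal]; simpa using hu)
  rw [zero_add] at h
  refine h.congr_fun fun k ↦ ?_
  rw [binomialSeries_apply]
  simp

theorem summable_norm_choose_mul_pow (x : ℂ) {r : ℝ} (h0 : 0 ≤ r) (h1 : r < 1) :
    Summable fun k : ℕ ↦ ‖Ring.choose x k‖ * r ^ k := by
  have hr : ‖(r : ℂ)‖ = r := by rw [Complex.norm_real, Real.norm_of_nonneg h0]
  refine (hasSum_choose_mul_pow x (u := (r : ℂ)) (by rwa [hr])).summable.norm.congr fun k ↦ ?_
  rw [norm_mul, norm_pow, hr]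

theorem hasSum_choose_succ_mul_pow (x : ℂ) {u : ℂ}
    (h : HasSum (fun k : ℕ ↦ Ring.choose x k * u ^ k) ((1 + u) ^ x)) :
    HasSum (fun k : ℕ ↦ Ring.choose x (k + 1) * u ^ (k + 1)) ((1 + u) ^ x - 1) := by
  have := (hasSum_nat_add_iff' 1).2 h
  simpa using this

theorem hasSum_natCast_choose_mul_pow (n : ℕ) (u : ℂ) :
    HasSum (fun k : ℕ ↦ Ring.choose (n : ℂ) k * u ^ k) ((1 + u) ^ (n : ℂ)) := by
  rw [Complex.cpow_natCast, add_comm, add_pow]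
  have h : ∀ k ∉ Finset.range (n + 1), Ring.choose (n : ℂ) k * u ^ k = 0 := fun k hk ↦ by
    rw [Ring.choose_natCast, Nat.choose_eq_zero_of_lt (by simpa using hk)]
    simp
  have h1 : HasSum (fun k : ℕ ↦ Ring.choose (n : ℂ) k * u ^ k)
      (∑ k ∈ Finset.range (n + 1), Ring.choose (n : ℂ) k * u ^ k) := hasSum_sum_of_ne_finset_zero h
  convert! h1 using 1
  refine Finset.sum_congr rfl fun k _ ↦ ?_
  rw [Ring.choose_natCast, one_pow, mul_one, mul_comm]

/-! ### Expansion of the paired sum -/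

theorem div_sub_eq_one_add {ρ τ : ℂ} (h : ρ - τ ≠ 0) : ρ / (ρ - τ) = 1 + τ * (ρ - τ)⁻¹ := by
  field_simp
  ring

theorem sub_ofReal_ne_zero (τ : ℝ) {ρ : ℂ} (hρ : ρ ∈ zetaZeros) : ρ - τ ≠ 0 :=
  sub_ne_zero_of_mem_zetaZeros (xi_ofReal_ne_zero τ) hρ

theorem zeroTerm_eq (x : ℂ) (τ : ℝ) {ρ : ℂ} (hρ : ρ ∈ zetaZeros) :
    zeroTerm x τ ρ = 1 - (1 + τ * (ρ - τ)⁻¹) ^ x := by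
  rw [zeroTerm, div_sub_eq_one_add (sub_ofReal_ne_zero τ hρ)]

/-- The expansion of the paired sum, multiplied by `τ`. -/
theorem hasSum_choose_mul_zetaZeroPowerSum (x : ℂ) (τ : ℝ) {K : ℝ} (hK : 0 < K)
    (hv : ∀ ρ ∈ zetaZeros, ‖(ρ - τ)⁻¹‖ ≤ K)
    (hc : Summable fun k ↦ ‖Ring.choose x k‖ * (|τ| * K) ^ k)
    (hu : ∀ ρ ∈ zetaZeros, HasSum (fun k : ℕ ↦ Ring.choose x k * (τ * (ρ - τ)⁻¹) ^ k)
      ((1 + τ * (ρ - τ)⁻¹) ^ x)) :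
    HasSum (fun k : ℕ ↦ Ring.choose x (k + 1) * (τ : ℂ) ^ (k + 1) * ell k τ)
      (∑' ρ : zetaZeros, pairedTerm x τ ρ) := by
  have hc' : Summable fun k : ℕ ↦ ‖Ring.choose x (k + 1) * (τ : ℂ) ^ (k + 1)‖ * K ^ k := by
    refine (((summable_nat_add_iff 1).2 hc).div_const K).congr fun k ↦ ?_
    rw [norm_mul, norm_pow, Complex.norm_real, Real.norm_eq_abs]
    field_simp
    ring
  have h := hasSum_mul_zetaZeroPowerSum (xi_ofReal_ne_zero τ) hK hv hc'
    (φ := fun ρ ↦ -zeroTerm x τ ρ) fun ρ hρ ↦ by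
      have := hasSum_choose_succ_mul_pow x (hu ρ hρ)
      simp only [zeroTerm_eq x τ hρ, neg_sub]
      exact this.congr_fun fun k ↦ by ring
  have h' := h.neg
  have h1 : ∑' ρ : zetaZeros, pairedTerm x τ ρ =
      -∑' ρ : zetaZeros, (zetaMult ρ : ℂ) * ((-zeroTerm x τ ρ + -zeroTerm x τ (1 - ρ)) / 2) := by
    rw [← tsum_neg]
    refine tsum_congr fun ρ ↦ ?_
    rw [pairedTerm]
    ring
  rw [h1]
  refine h'.congr_fun fun k ↦ ?_
  rw [ell_eq_neg_zetaZeroPowerSum]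
  ring

theorem hasSum_tsum_pairedTerm (x : ℂ) (τ : ℝ)
    (h : (∀ ρ ∈ zetaZeros, |τ| < ‖ρ - (τ : ℂ)‖) ∨ ∃ n : ℕ, x = n) :
    HasSum (fun k : ℕ ↦ Ring.choose x (k + 1) * (τ : ℂ) ^ (k + 1) * ell k τ)
      (∑' ρ : zetaZeros, pairedTerm x τ ρ) := by
  rcases h with h | ⟨n, rfl⟩
  · obtain ⟨K, hK, hK1, hv⟩ : ∃ K : ℝ, 0 < K ∧ |τ| * K < 1 ∧
        ∀ ρ ∈ zetaZeros, ‖(ρ - (τ : ℂ))⁻¹‖ ≤ K := by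
      rcases eq_or_ne τ 0 with h0 | h0
      · obtain ⟨K, hK, hv⟩ := exists_norm_inv_zetaZeros_sub_le (τ : ℂ)
        exact ⟨K, hK, by simp [h0], hv⟩
      · have hτ := abs_pos.2 h0
        obtain ⟨K, hK, hlt, hv⟩ := exists_lt_forall_le_of_tendsto_cofinite
          (tendsto_norm_inv_zetaZeros_sub (τ : ℂ)) (inv_pos.2 hτ) fun ρ ↦ by
            rw [norm_inv]
            exact inv_strictAnti₀ hτ (h ρ ρ.2)
        refine ⟨K, hK, ?_, fun ρ hρ ↦ hv ⟨ρ, hρ⟩⟩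
        rw [mul_comm]
        exact (lt_div_iff₀ hτ).1 (by rwa [one_div])
    refine hasSum_choose_mul_zetaZeroPowerSum x τ hK hv
      (summable_norm_choose_mul_pow x (by positivity) hK1) fun ρ hρ ↦ hasSum_choose_mul_pow x ?_
    rw [norm_mul, Complex.norm_real, Real.norm_eq_abs]
    exact (mul_le_mul_of_nonneg_left (hv ρ hρ) (abs_nonneg τ)).trans_lt hK1
  -- For a natural exponent the binomial series is a finite sum, so |τ|K < 1 is not required.
  · obtain ⟨K, hK, hv⟩ := exists_norm_inv_zetaZeros_sub_le (τ : ℂ)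
    refine hasSum_choose_mul_zetaZeroPowerSum n τ hK hv ?_ fun ρ _ ↦
      hasSum_natCast_choose_mul_pow n _
    refine summable_of_ne_finset_zero (s := Finset.range (n + 1)) fun k hk ↦ ?_
    rw [Ring.choose_natCast, Nat.choose_eq_zero_of_lt (by simpa using hk)]
    simp

/-! ### Convergence of the paired sum and the limit at τ = 0 -/

/-- The first order Taylor bound for `(1 + u) ^ x` at `u = 0`. -/
theorem exists_norm_one_sub_one_add_cpow_add_le (x : ℂ) : ∃ C δ : ℝ, 0 ≤ C ∧ 0 < δ ∧
    ∀ u : ℂ, ‖u‖ < δ → ‖1 - (1 + u) ^ x + x * u‖ ≤ C * ‖u‖ ^ 2 := by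
  have h := (Complex.one_add_cpow_hasFPowerSeriesAt_zero (a := x)).isBigO_sub_partialSum_pow 2
  obtain ⟨C, hC, h⟩ := h.exists_nonneg
  obtain ⟨δ, hδ, h⟩ := Metric.eventually_nhds_iff.1 h.bound
  refine ⟨C, δ, hC, hδ, fun u hu ↦ ?_⟩
  have h1 := h (y := u) (by simpa using hu)
  have h2 : (binomialSeries ℂ x).partialSum 2 u = 1 + x * u := by
    simp only [FormalMultilinearSeries.partialSum, binomialSeries_apply]
    simp [Finset.sum_range_succ]
  rw [h2, zero_add, norm_pow, norm_norm, ← norm_neg] at h1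
  convert! h1 using 2
  ring

/-- With u = τ/(ρ - τ), the linear part -xu of each summand is split off. Its paired sum is known
from the partial fractions, and the rest is dominated by inverse squares. -/
theorem norm_pairedTerm_add_le {x : ℂ} {C δ : ℝ}
    (hC : ∀ u : ℂ, ‖u‖ < δ → ‖1 - (1 + u) ^ x + x * u‖ ≤ C * ‖u‖ ^ 2) (τ : ℝ) (ρ : zetaZeros)
    (h1 : |τ| * ‖((ρ : ℂ) - τ)⁻¹‖ < δ) (h2 : |τ| * ‖(1 - (ρ : ℂ) - τ)⁻¹‖ < δ) :
    ‖pairedTerm x τ ρ + x * τ * ((zetaMult ρ : ℂ) *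
      ((((ρ : ℂ) - τ)⁻¹ + (1 - (ρ : ℂ) - τ)⁻¹) / 2))‖ ≤
      C * |τ| ^ 2 / 2 * ((zetaMult ρ : ℝ) * ‖((ρ : ℂ) - τ)⁻¹‖ ^ 2 +
        (zetaMult ρ : ℝ) * ‖(1 - (ρ : ℂ) - τ)⁻¹‖ ^ 2) := by
  have hn : ∀ z : ℂ, ‖(τ : ℂ) * z‖ = |τ| * ‖z‖ := fun z ↦ by
    rw [norm_mul, Complex.norm_real, Real.norm_eq_abs]
  have h3 := hC (τ * ((ρ : ℂ) - τ)⁻¹) (by rwa [hn])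
  have h4 := hC (τ * (1 - (ρ : ℂ) - τ)⁻¹) (by rwa [hn])
  rw [hn, ← zeroTerm_eq x τ ρ.2] at h3
  rw [hn, ← zeroTerm_eq x τ (one_sub_mem_zetaZeros ρ.2)] at h4
  have h5 : pairedTerm x τ ρ + x * τ * ((zetaMult ρ : ℂ) *
      ((((ρ : ℂ) - τ)⁻¹ + (1 - (ρ : ℂ) - τ)⁻¹) / 2)) = (zetaMult ρ : ℂ) *
      (((zeroTerm x τ ρ + x * (τ * ((ρ : ℂ) - τ)⁻¹)) +
        (zeroTerm x τ (1 - ρ) + x * (τ * (1 - (ρ : ℂ) - τ)⁻¹))) / 2) := by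
    rw [pairedTerm]
    ring
  rw [h5, norm_mul, norm_div, Complex.norm_natCast, Complex.norm_ofNat]
  calc _ ≤ (zetaMult ρ : ℝ) * ((C * (|τ| * ‖((ρ : ℂ) - τ)⁻¹‖) ^ 2 +
        C * (|τ| * ‖(1 - (ρ : ℂ) - τ)⁻¹‖) ^ 2) / 2) := by
        gcongr
        exact (norm_add_le _ _).trans (add_le_add h3 h4)
    _ = _ := by ring

theorem eventually_cofinite_oneSub {p : ℂ → Prop}
    (h : ∀ᶠ ρ : zetaZeros in cofinite, p ρ) : ∀ᶠ ρ : zetaZeros in cofinite, p (1 - ρ) :=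
  zetaZerosOneSub.injective.tendsto_cofinite.eventually h

theorem summable_pairedTerm (x : ℂ) (τ : ℝ) : Summable (pairedTerm x τ) := by
  obtain ⟨C, δ, -, hδ, hC⟩ := exists_norm_one_sub_one_add_cpow_add_le x
  have h1 : ∀ᶠ ρ : zetaZeros in cofinite, |τ| * ‖((ρ : ℂ) - τ)⁻¹‖ < δ := by
    have := (tendsto_norm_inv_zetaZeros_sub (τ : ℂ)).const_mul |τ|
    rw [mul_zero] at this
    exact this.eventually_lt_const hδ
  have hxi := xi_ofReal_ne_zero τ
  have h2 : Summable fun ρ : zetaZeros ↦ pairedTerm x τ ρ + x * τ * ((zetaMult ρ : ℂ) *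
      ((((ρ : ℂ) - τ)⁻¹ + (1 - (ρ : ℂ) - τ)⁻¹) / 2)) := by
    refine Summable.of_norm_bounded_eventually (((summable_zetaMult_mul_norm_sq (τ : ℂ)).add
      (summable_zetaMult_mul_norm_sq_oneSub (τ : ℂ))).mul_left (C * |τ| ^ 2 / 2)) ?_
    filter_upwards [h1, eventually_cofinite_oneSub
      (p := fun ρ ↦ |τ| * ‖(ρ - (τ : ℂ))⁻¹‖ < δ) h1] with ρ h1 h2
    exact norm_pairedTerm_add_le hC τ ρ h1 h2
  have h3 := h2.sub ((hasSum_logDeriv_xi hxi).summable.mul_left (x * τ))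
  exact h3.congr fun ρ ↦ by ring

theorem ell_zero_eq (τ : ℝ) : ell 0 τ = logDeriv xi τ := by
  simp [ell, logDeriv_apply]

theorem exists_norm_zeroSum_sub_le (x : ℂ) : ∃ B : ℝ, ∀ᶠ τ : ℝ in 𝓝[≠] 0,
    ‖zeroSum x τ - x * ell 0 τ‖ ≤ |τ| * B := by
  obtain ⟨C, δ, hC0, hδ, hC⟩ := exists_norm_one_sub_one_add_cpow_add_le x
  obtain ⟨K, hK, hv⟩ := exists_norm_inv_zetaZeros_sub_le 0
  have hsum := (summable_zetaMult_mul_norm_sq 0).add (summable_zetaMult_mul_norm_sq_oneSub 0)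
  refine ⟨2 * C * ∑' ρ : zetaZeros, ((zetaMult ρ : ℝ) * ‖((ρ : ℂ) - 0)⁻¹‖ ^ 2 +
        (zetaMult ρ : ℝ) * ‖(1 - (ρ : ℂ) - 0)⁻¹‖ ^ 2), ?_⟩
  -- As |ρ| ≥ 1/K, the first bound gives |ρ - τ| ≥ |ρ|/2, hence a majorant independent of τ. The
  -- second then gives |τ/(ρ - τ)| < δ for every zero.
  have hev : ∀ᶠ τ : ℝ in 𝓝[≠] 0, |τ| < min (1 / (2 * K)) (δ / (2 * K)) := by
    have : Tendsto (fun τ : ℝ ↦ |τ|) (𝓝[≠] 0) (𝓝 |0|) :=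
      (continuous_abs.tendsto 0).mono_left nhdsWithin_le_nhds
    rw [abs_zero] at this
    exact this.eventually_lt_const (by positivity)
  filter_upwards [hev, self_mem_nhdsWithin] with τ hτ hτ0
  have hτ1 : |τ| * (2 * K) < 1 := (lt_div_iff₀ (by positivity)).1 (hτ.trans_le (min_le_left _ _))
  have hτ2 : |τ| * (2 * K) < δ := (lt_div_iff₀ (by positivity)).1 (hτ.trans_le (min_le_right _ _))
  have hinv : ∀ ρ ∈ zetaZeros, ‖(ρ - (τ : ℂ))⁻¹‖ ≤ 2 * ‖(ρ - 0)⁻¹‖ := by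
    intro ρ hρ
    have h0 : ρ - 0 ≠ 0 := sub_ne_zero_of_mem_zetaZeros (by simp [xi_zero]) hρ
    have h1 := hv ρ hρ
    have h2 := norm_pos_iff.2 h0
    have h3 := norm_pos_iff.2 (sub_ofReal_ne_zero τ hρ)
    have h4 : ‖ρ - 0‖ - |τ| ≤ ‖ρ - (τ : ℂ)‖ := by
      have := norm_sub_norm_le ρ (τ : ℂ)
      rw [sub_zero]
      rwa [Complex.norm_real, Real.norm_eq_abs] at this
    rw [norm_inv] at h1
    rw [norm_inv, norm_inv, inv_le_iff_one_le_mul₀ h3]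
    rw [inv_le_iff_one_le_mul₀ h2] at h1
    have h5 : 2 * |τ| ≤ ‖ρ - 0‖ := by nlinarith [abs_nonneg τ]
    field_simp
    linarith
  have hlt : ∀ ρ ∈ zetaZeros, |τ| * ‖(ρ - (τ : ℂ))⁻¹‖ < δ := fun ρ hρ ↦ by
    refine lt_of_le_of_lt ?_ hτ2
    gcongr
    exact (hinv ρ hρ).trans (by linarith [hv ρ hρ])
  have hxi := xi_ofReal_ne_zero τ
  have h1 := (summable_pairedTerm x τ).hasSum.add ((hasSum_logDeriv_xi hxi).mul_left (x * τ))
  have h2 : ‖(∑' ρ : zetaZeros, pairedTerm x τ ρ) + x * τ * -logDeriv xi τ‖ ≤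
      2 * C * |τ| ^ 2 * ∑' ρ : zetaZeros, ((zetaMult ρ : ℝ) * ‖((ρ : ℂ) - 0)⁻¹‖ ^ 2 +
        (zetaMult ρ : ℝ) * ‖(1 - (ρ : ℂ) - 0)⁻¹‖ ^ 2) := by
    rw [← h1.tsum_eq]
    refine tsum_of_norm_bounded (hsum.hasSum.mul_left _) fun ρ ↦ ?_
    refine (norm_pairedTerm_add_le hC τ ρ (hlt ρ ρ.2)
      (hlt _ (one_sub_mem_zetaZeros ρ.2))).trans ?_
    have h3 := hinv ρ ρ.2
    have h4 := hinv _ (one_sub_mem_zetaZeros ρ.2)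
    calc _ ≤ C * |τ| ^ 2 / 2 * ((zetaMult ρ : ℝ) * (2 * ‖((ρ : ℂ) - 0)⁻¹‖) ^ 2 +
        (zetaMult ρ : ℝ) * (2 * ‖(1 - (ρ : ℂ) - 0)⁻¹‖) ^ 2) := by gcongr
      _ = _ := by ring
  have hτc : (τ : ℂ) ≠ 0 := by exact_mod_cast hτ0
  have hτp : 0 < |τ| := abs_pos.2 hτ0
  have h5 : zeroSum x τ - x * ell 0 τ =
      (τ : ℂ)⁻¹ * ((∑' ρ : zetaZeros, pairedTerm x τ ρ) + x * τ * -logDeriv xi τ) := by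
    rw [zeroSum, ell_zero_eq]
    field_simp
    ring
  rw [h5, norm_mul, norm_inv, Complex.norm_real, Real.norm_eq_abs, inv_mul_le_iff₀ hτp]
  refine h2.trans_eq ?_
  ring

theorem tendsto_zeroSum (x : ℂ) : Tendsto (zeroSum x) (𝓝[≠] 0) (𝓝 (x * ell 0 0)) := by
  obtain ⟨B, hB⟩ := exists_norm_zeroSum_sub_le x
  have h1 : Tendsto (fun τ : ℝ ↦ |τ| * B) (𝓝[≠] 0) (𝓝 0) := by
    have : Tendsto (fun τ : ℝ ↦ |τ| * B) (𝓝[≠] 0) (𝓝 (|0| * B)) :=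
      ((continuous_abs.mul continuous_const).tendsto 0).mono_left nhdsWithin_le_nhds
    simpa using this
  have h2 := squeeze_zero_norm' hB h1
  have h3 : Tendsto (fun τ : ℝ ↦ x * ell 0 τ) (𝓝[≠] 0) (𝓝 (x * ell 0 0)) := by
    simp only [ell_zero_eq]
    refine Tendsto.const_mul x (Tendsto.mono_left ?_ nhdsWithin_le_nhds)
    have hc : ContinuousAt (logDeriv xi) ((0 : ℝ) : ℂ) :=
      (((differentiable_xi.deriv).continuous.continuousAt).div
        differentiable_xi.continuous.continuousAt (xi_ofReal_ne_zero 0))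
    exact hc.tendsto.comp (Complex.continuous_ofReal.tendsto 0)
  simpa using h2.add h3

theorem F_zero (x : ℂ) : F x 0 = x * ell 0 0 := by
  rw [F, if_pos rfl]
  exact (tendsto_zeroSum x).limUnder_eq

theorem tendsto_F (x : ℂ) : Tendsto (F x) (𝓝[≠] (0 : ℝ)) (𝓝 (F x 0)) := by
  rw [F_zero]
  refine (tendsto_zeroSum x).congr' ?_
  filter_upwards [self_mem_nhdsWithin] with τ hτ
  rw [F, if_neg (show τ ≠ 0 from hτ)]

/-! ### The theorem -/

/-- In ℂ, `Summable` and `HasSum` entail absolute convergence. The `Tendsto` clause carries content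
because `limUnder` has a value even where no limit exists. -/
theorem theorem5p6 (x : ℂ) :
    -- the function `F` is well defined
    (∀ τ : ℝ, Summable (pairedTerm x τ)) ∧
    Tendsto (F x) (𝓝[≠] (0 : ℝ)) (𝓝 (F x 0)) ∧
    -- the expansion, where the binomial series converge
    ∀ τ : ℝ, ((∀ ρ ∈ zetaZeros, |τ| < ‖ρ - (τ : ℂ)‖) ∨ ∃ n : ℕ, x = n) →
      HasSum (fun k : ℕ => gammaQuot x k / ((k + 1).factorial : ℂ) * ell k τ * (τ : ℂ) ^ k)
        (F x τ) := by
  refine ⟨summable_pairedTerm x, tendsto_F x, fun τ h ↦ ?_⟩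
  simp only [gammaQuot_div_factorial]
  rcases eq_or_ne τ 0 with rfl | hτ
  · rw [F_zero]
    -- At τ = 0 only k = 0 survives, with 0^0 = 1.
    have h1 := hasSum_single (f := fun k : ℕ ↦
      Ring.choose x (k + 1) * ell k 0 * ((0 : ℝ) : ℂ) ^ k) 0 fun k hk ↦ by simp [hk]
    simpa using h1
  · have hτc : (τ : ℂ) ≠ 0 := by exact_mod_cast hτ
    rw [F, if_neg hτ, zeroSum]
    refine ((hasSum_tsum_pairedTerm x τ h).mul_left (1 / (τ : ℂ))).congr_fun fun k ↦ ?_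
    field_simp
    ring
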